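/- Let $\mathbb F_q$ be a finite field with $q$ elements, let $N\ge 6$ and $M\ge 1$ be integers, let $H$ be an $\mathbb F_q$-vector space of dimension $N+M$ and $h\subseteq H$ a subspace of dimension $M$. Let $P=\mathcal A_q(N,M)$ be the poset of all subspaces $x$ of $H$ with $x\cap h=0$, ordered by inclusion. Let $R,L\in\mathrm{Mat}_P(\mathbb C)$ be the raising and lowering matrices ($R_{xy}=1$ if $x$ covers $y$ and $0$ otherwise; $L=R^t$), and for $0\le i\le N$ let $F_i$ be the diagonal matrix with $(F_i)_{yy}=1$ if $\dim y=i$ and $0$ otherwise. Put $$A=\sum_{i=0}^{N-1}\alpha_i RF_i+\sum_{i=0}^N\theta_iF_i,\qquad A^*=\sum_{i=1}^{N}\alpha^*_i LF_i+\sum_{i=0}^N\theta^*_iF_i,$$ where the $\alpha_i$ $(0\le i\le N-1)$ and $\alpha_i^*$ $(1\le i\le N)$ are nonzero complex numbers, $\theta_0,\dots,\theta_N\in\mathbb C$ are mutually distinct, and $\theta^*_0,\dots,\theta^*_N\in\mathbb C$ are mutually distinct. Put $\xi_i=\alpha_i\alpha^*_{i+1}$ for $0\le i\le N-1$. Let $\beta,\gamma,\gamma^*,\varrho,\varrho^*\in\mathbb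 C$ and suppose that the tridiagonal relations $$[A,\;A^2A^*-\beta AA^*A+A^*A^2-\gamma(AA^*+A^*A)-\varrho A^*]=0,$$ $$[A^*,\;A^{*2}A-\beta A^*AA^*+AA^{*2}-\gamma^*(A^*A+AA^*)-\varrho^* A]=0$$ hold. Then $\beta=q+q^{-1}$. Moreover, for every nonzero $Q\in\mathbb C$ with $\beta=Q+Q^{-1}$, one has $Q\in\{q,q^{-1}\}$ and there are $a,b,c,a^*,b^*,c^*,x\in\mathbb C$ such that $\xi_i$ $(0\le i\le N-1)$ and $\theta_i,\theta_i^*$ $(0\le i\le N)$ are given by one of the following eight cases. Case I ($Q=q$, $c\ne0$, $c^*\neq 0$): $\xi_i=x-q^{-1-N-M-i}(q-1)^2cc^*$, and - I$^+$ ($b\ne0$, $b^*=0$): $\theta_i=a+bq^i+cq^{-i}$, $\theta_i^*=a^*+c^*q^{-i}$; - I$^-$ ($b=0$, $b^*\neq0$): $\theta_i=a+cq^{-i}$, $\theta_i^*=a^*+b^*q^i+c^*q^{-i}$; - I$^0$ ($b=b^*=0$): $\theta_i=a+cq^{-i}$, $\theta_i^*=a^*+c^*q^{-i}$. Case II ($Q=q^{-1}$,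 $b\neq0$, $b^*\ne0$): $\xi_i=x-q^{-1-N-M-i}(q-1)^2bb^*$, and - II$^+$ ($c\neq0$, $c^*=0$): $\theta_i=a+bq^{-i}+cq^{i}$, $\theta_i^*=a^*+b^*q^{-i}$; - II$^-$ ($c=0$, $c^*\ne0$): $\theta_i=a+bq^{-i}$, $\theta_i^*=a^*+b^*q^{-i}+c^*q^{i}$; - II$^0$ ($c=c^*=0$): $\theta_i=a+bq^{-i}$, $\theta_i^*=a^*+b^*q^{-i}$. Case III ($x\neq0$, $Q\in\{q,q^{-1}\}$): $\xi_i=x$, and - III$^+$ ($b\ne0$, $b^*=0$, $c=0$, $c^*\ne0$): $\theta_i=a+bq^i$, $\theta^*_i=a^*+c^*q^{-i}$; - III$^-$ ($b=0$, $b^*\ne0$, $c\ne0$, $c^*=0$): $\theta_i=a+cq^{-i}$, $\theta^*_i=a^*+b^*q^i$. -/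

import Mathlib

/-- The attenuated space poset attached to a subspace `h` of `H`: all subspaces of `H` that meet `h`
trivially. It is `A_q(N, M)` when `dim H = N + M` and `dim h = M` over the field with `q` elements. -/
def AttenuatedSpace {F H : Type*} [Field F] [AddCommGroup H] [Module F H]
    (h : Submodule F H) : Type _ :=
  {x : Submodule F H // x ⊓ h = ⊥}

namespace AttenuatedSpace

section

variable {F H : Type*} [Field F] [AddCommGroup H] [Module F H] (h : Submodule F H)

/-- The order is inclusion of subspaces. -/
instance : PartialOrder (AttenuatedSpace h) :=
  inferInstanceAs (PartialOrder {x : Submodule F H // x ⊓ h = ⊥})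

noncomputable instance : DecidableEq (AttenuatedSpace h) :=
  Classical.decEq _

noncomputable instance [Finite F] [FiniteDimensional F H] : Fintype (AttenuatedSpace h) :=
  haveI : Finite H := Module.finite_of_finite F
  haveI : Finite (AttenuatedSpace h) :=
    inferInstanceAs (Finite {x : Submodule F H // x ⊓ h = ⊥})
  Fintype.ofFinite _

open scoped Classical in
/-- The lowering matrix: the `(x, y)`-entry is `1` if `y` covers `x`, and `0` otherwise. -/
noncomputable def lowering : Matrix (AttenuatedSpace h) (AttenuatedSpace h) ℂ :=
  Matrix.of fun x y => if x ⋖ y then 1 else 0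

open scoped Classical in
/-- The raising matrix: the `(x, y)`-entry is `1` if `x` covers `y`, and `0` otherwise. -/
noncomputable def raising : Matrix (AttenuatedSpace h) (AttenuatedSpace h) ℂ :=
  Matrix.of fun x y => if y ⋖ x then 1 else 0

/-- The `i`th projection matrix: the diagonal matrix whose `(y, y)`-entry is `1` if `dim y = i`,
and `0` otherwise. -/
noncomputable def proj (i : ℕ) : Matrix (AttenuatedSpace h) (AttenuatedSpace h) ℂ :=
  Matrix.diagonal fun y => if Module.finrank F y.1 = i then 1 else 0

variable [Finite F] [FiniteDimensional F H]

/-- `A = ∑_{i=0}^{N-1} α_i R F_i + ∑_{i=0}^{N} θ_i F_i`. -/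
noncomputable def matA (N : ℕ) (α θ : ℕ → ℂ) :
    Matrix (AttenuatedSpace h) (AttenuatedSpace h) ℂ :=
  ∑ i ∈ Finset.range N, α i • (raising h * proj h i) +
    ∑ i ∈ Finset.range (N + 1), θ i • proj h i

/-- `A* = ∑_{i=1}^{N} α*_i L F_i + ∑_{i=0}^{N} θ*_i F_i`. -/
noncomputable def matAStar (N : ℕ) (α' θ' : ℕ → ℂ) :
    Matrix (AttenuatedSpace h) (AttenuatedSpace h) ℂ :=
  ∑ i ∈ Finset.Icc 1 N, α' i • (lowering h * proj h i) +
    ∑ i ∈ Finset.range (N + 1), θ' i • proj h i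

end

end AttenuatedSpace

/-- The element `[X, X²Y - β X Y X + Y X² - γ (X Y + Y X) - ϱ Y]` of a complex algebra, whose
vanishing is a tridiagonal relation. -/
def tridiagonalElement {T : Type*} [Ring T] [Algebra ℂ T] (β γ ϱ : ℂ) (X Y : T) : T :=
  ⁅X, X ^ 2 * Y - β • (X * Y * X) + Y * X ^ 2 - γ • (X * Y + Y * X) - ϱ • Y⁆

/-- The sequences `ξ_0, …, ξ_{N-1}`, `θ_0, …, θ_N`, `θ*_0, …, θ*_N` agree with the entries
`f, g, g'` of a row of a table. -/
def FitsRow (N : ℕ) (ξ θ θ' f g g' : ℕ → ℂ) : Prop :=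
  (∀ i < N, ξ i = f i) ∧ (∀ i ≤ N, θ i = g i) ∧ (∀ i ≤ N, θ' i = g' i)

/-!
Let `R` and `L` be the raising and lowering matrices of the poset. A function `f` on the poset such
that `f R` and `f L` are multiples of `f` on each level, by factors `n i` and `m i` on level `i`,
spans with its restrictions to the levels a space of row vectors stable under `A` and `A*`
(`IsLevelEigenvector`). On the coefficients of these restrictions `A` and `A*` become bidiagonal
(`raiseOp`, `lowerOp`), and the relation `[A, A²A* - βAA*A + A*A² - γ(AA* + A*A) - ϱA*] = 0` becomes
a scalar one (`AttenuatedSpace.tridiagonalOp_eq_zero`). Its components are as follows.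

* Degree `-1` gives `θ_i + θ_{i+2} - β θ_{i+1} = γ`, and degree `3` gives the third-order recurrence
  `thirdDiff β θ* = 0`.
* Degree `2` gives `thirdDiff β (ξ λ) = (β + 1)(τ_{j+1} - τ_{j+2})`, where `λ_i = n_i m_{i+1}` and
  `τ_i = (θ_{i+1} - θ_i)(θ*_{i+1} - θ*_i)`; see `AttenuatedSpace.IsLevelEigenvector.thirdDiff_eq`.

With `[k] = (q^k - 1)/(q - 1)`, three level eigenvectors are used: the constant function `1`, with
`n_i = q^M [N - i]` and `m_i = [i]`; the difference of the indicator functions of `v ∈ x` and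
`v + k ∈ x` with `v ∉ h` and `0 ≠ k ∈ h`, with `n_i = q^M [N - i]` and `m_i = [i - 1]`; and the
difference of the indicator functions of `v ∈ x + h` and `w ∈ x + h`, with
`n_i = q^M ([N - i] - 1)` and `m_i = [i - 1]`. The factors come from double counting vectors
(`sum_covers`) and linear functionals (`sum_cocovers_ge`).

The right-hand side in degree `2` does not depend on the eigenvector, so differences of the three
equations are homogeneous in `ξ` (`LevelRelations`). They leave two possibilities
(`eq_add_inv_or_geometric`): either `β = q + q⁻¹`, or `ξ_i = ξ_0 t^i` with `q t² = 1` and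
`β = t + t⁻¹`. In the second case the equation of the constant function has a nonzero multiple of
`t^{3j}` on the left and a combination of `t^{2j}` and `t^{-2j}` on the right, which is impossible.
In the first case `θ_i = a + b q^i + c q^{-i}`, `θ*_i = a* + b* q^i + c* q^{-i}` and
`ξ_i = x + y q^{-i}`, and the same equation says that `b b* = 0` and
`y = -q^{-1-N-M} (q - 1)² c c*` (`LevelRelations.exists_parameters`). The rows of the table are the
ways in which `b b* = 0` can hold, according to whether `c c*` vanishes.
-/

section

open Module Submodule Matrix

/-! ### Subspaces of a finite vector space and counting covers -/

theorem Submodule.disjoint_sup_span_singleton {F H : Type*} [Field F] [AddCommGroup H] [Module F H]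
    {y K : Submodule F H} (hyK : Disjoint y K) {v : H} (hv : v ∉ y ⊔ K) :
    Disjoint (y ⊔ span F {v}) K := by
  rw [Submodule.disjoint_def] at hyK ⊢
  intro w hw hwK
  obtain ⟨a, ha, b, hb, rfl⟩ := mem_sup.1 hw
  obtain ⟨c, rfl⟩ := mem_span_singleton.1 hb
  by_cases hc : c = 0
  · subst hc
    simp only [zero_smul, add_zero] at hwK ⊢
    exact hyK a ha hwK
  · refine absurd ?_ hv
    have : v = c⁻¹ • ((a + c • v) - a) := by simp [hc]
    rw [this]
    exact smul_mem _ _ (sub_mem (mem_sup_right hwK) (mem_sup_left ha))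

theorem Submodule.exists_disjoint_finrank_eq {F H : Type*} [Field F] [AddCommGroup H] [Module F H]
    [FiniteDimensional F H] {U K : Submodule F H} (hUK : Disjoint U K) {i : ℕ}
    (hi : finrank F U ≤ i) (hiK : i + finrank F K ≤ finrank F H) :
    ∃ y : Submodule F H, U ≤ y ∧ Disjoint y K ∧ finrank F y = i := by
  induction i, hi using Nat.le_induction with
  | base => exact ⟨U, le_rfl, hUK, rfl⟩
  | succ i hi ih =>
    obtain ⟨y, hUy, hyK, rfl⟩ := ih (by omega)
    have hne : y ⊔ K ≠ ⊤ := fun e => by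
      have := finrank_sup_add_finrank_inf_eq y K
      rw [e, hyK.eq_bot, finrank_top, finrank_bot] at this
      omega
    obtain ⟨v, -, hv⟩ := SetLike.exists_of_lt hne.lt_top
    exact ⟨y ⊔ span F {v}, hUy.trans le_sup_left, disjoint_sup_span_singleton hyK hv,
      finrank_sup_span_singleton fun hvy => hv (mem_sup_left hvy)⟩

open scoped Classical in
theorem Submodule.sum_indicator_mem {F : Type*} [Field F] [Fintype F] {H : Type*}
    [AddCommGroup H] [Module F H] [FiniteDimensional F H] [Fintype H] (W : Submodule F H) :
    (∑ v : H, if v ∈ W then (1 : ℂ) else 0) = (Fintype.card F : ℂ) ^ finrank F W := by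
  rw [Finset.sum_boole, ← Nat.cast_pow, ← Module.card_eq_pow_finrank (K := F) (V := W),
    Fintype.card_subtype]

namespace AttenuatedSpace

variable {F H : Type*} [Field F] [AddCommGroup H] [Module F H] {h : Submodule F H}

/-- The subspace of `H` underlying an element of the poset. -/
def space (x : AttenuatedSpace h) : Submodule F H := x.1

theorem space_inf (x : AttenuatedSpace h) : x.space ⊓ h = ⊥ := x.2

theorem space_injective : Function.Injective (space : AttenuatedSpace h → Submodule F H) :=
  Subtype.val_injective

/-- A subspace of `H` disjoint from `h`, as an element of the poset. -/
def ofDisjoint (W : Submodule F H) (hW : Disjoint W h) : AttenuatedSpace h :=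
  ⟨W, hW.eq_bot⟩

@[simp]
theorem space_ofDisjoint (W : Submodule F H) (hW : Disjoint W h) :
    (ofDisjoint W hW).space = W := rfl

theorem disjoint_space (x : AttenuatedSpace h) : Disjoint x.space h :=
  disjoint_iff.2 x.space_inf

/-- The poset is a lower set in the lattice of subspaces, so covers raise the dimension by one. -/
theorem covBy_iff_finrank [FiniteDimensional F H] {x y : AttenuatedSpace h} :
    x ⋖ y ↔ x.space ≤ y.space ∧ finrank F y.space = finrank F x.space + 1 := by
  constructor
  · intro hxy
    have hlt : x.space < y.space := hxy.lt
    obtain ⟨v, hvy, hvx⟩ := SetLike.exists_of_lt hlt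
    have hle : x.space ⊔ span F {v} ≤ y.space := sup_le hlt.le (by simpa using hvy)
    let z : AttenuatedSpace h := ofDisjoint (x.space ⊔ span F {v}) (y.disjoint_space.mono_left hle)
    have hxz : x < z := (le_sup_left : x.space ≤ x.space ⊔ span F {v}).lt_of_ne fun e =>
      hvx (e ▸ mem_sup_right (mem_span_singleton_self v))
    have hzy : z = y := by
      by_contra hne
      exact hxy.2 hxz (lt_of_le_of_ne hle hne)
    refine ⟨hlt.le, ?_⟩
    rw [← hzy]
    exact finrank_sup_span_singleton hvx
  · rintro ⟨hle, hd⟩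
    refine ⟨lt_of_le_of_ne hle fun e => by rw [e] at hd; omega, fun z hxz hzy => ?_⟩
    have h1 : finrank F x.space < finrank F z.space := finrank_lt_finrank_of_lt hxz
    have h2 : finrank F z.space < finrank F y.space := finrank_lt_finrank_of_lt hzy
    omega

theorem mem_of_mem_sup_of_le {x y : AttenuatedSpace h} {v : H} (hyx : y.space ≤ x.space)
    (hvx : v ∈ x.space) (hv : v ∈ y.space ⊔ h) : v ∈ y.space := by
  obtain ⟨a, ha, b, hb, rfl⟩ := mem_sup.1 hv
  have : b ∈ x.space ⊓ h := ⟨by simpa using sub_mem hvx (hyx ha), hb⟩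
  rw [x.space_inf, mem_bot] at this
  simpa [this] using ha

open scoped Classical in
/-- A vector outside `y` lies in exactly one cover of `y` if it lies outside `y + h`, and in none
otherwise. -/
theorem sum_covers_mem_of_notMem [Finite F] [FiniteDimensional F H] (y : AttenuatedSpace h) {v : H}
    (hv : v ∉ y.space) :
    (∑ x : AttenuatedSpace h, if y ⋖ x ∧ v ∈ x.space then (1 : ℂ) else 0) =
      if v ∈ y.space ⊔ h then 0 else 1 := by
  split_ifs with hvh
  · refine Finset.sum_eq_zero fun x _ => if_neg ?_
    rintro ⟨hc, hvx⟩
    exact hv (mem_of_mem_sup_of_le hc.le hvx hvh)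
  · have hz := disjoint_sup_span_singleton y.disjoint_space hvh
    rw [Finset.sum_eq_single (ofDisjoint (y.space ⊔ span F {v}) hz)]
    · exact if_pos ⟨covBy_iff_finrank.2 ⟨le_sup_left, finrank_sup_span_singleton hv⟩,
        mem_sup_right (mem_span_singleton_self v)⟩
    · rintro x - hx
      refine if_neg ?_
      rintro ⟨hc, hvx⟩
      refine hx (space_injective ?_)
      obtain ⟨hle, hd⟩ := covBy_iff_finrank.1 hc
      exact (eq_of_le_of_finrank_eq (sup_le hle (by simpa using hvx))
        ((finrank_sup_span_singleton hv).trans hd.symm)).symm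
    · simp

open scoped Classical in
/-- The number of covers of `y`, times the number of vectors that each cover adds to `y`, is the
number of vectors outside `y + h`. -/
theorem sum_covers [Fintype F] [FiniteDimensional F H] (y : AttenuatedSpace h) :
    (∑ x : AttenuatedSpace h, if y ⋖ x then (1 : ℂ) else 0) *
        ((Fintype.card F : ℂ) ^ (finrank F y.space + 1) - (Fintype.card F : ℂ) ^ finrank F y.space) =
      (Fintype.card F : ℂ) ^ finrank F H - (Fintype.card F : ℂ) ^ (finrank F y.space + finrank F h) := by
  have : Finite H := Module.finite_of_finite F
  let _ : Fintype H := Fintype.ofFinite H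
  have hsup : finrank F ↥(y.space ⊔ h) = finrank F y.space + finrank F h := by
    have := finrank_sup_add_finrank_inf_eq y.space h
    rwa [y.space_inf, finrank_bot, add_zero] at this
  -- both sides count the pairs of a cover `x` of `y` and a vector of `x` outside `y`
  have key : (∑ x : AttenuatedSpace h, ∑ v : H,
      if y ⋖ x ∧ v ∈ x.space ∧ v ∉ y.space then (1 : ℂ) else 0) =
      ∑ v : H, ((if v ∈ (⊤ : Submodule F H) then (1 : ℂ) else 0) -
        if v ∈ y.space ⊔ h then (1 : ℂ) else 0) := by
    rw [Finset.sum_comm]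
    refine Finset.sum_congr rfl fun v _ => ?_
    by_cases hv : v ∈ y.space
    · have : v ∈ y.space ⊔ h := mem_sup_left hv
      simp [hv, this]
    · simp only [hv, not_false_eq_true, and_true]
      rw [sum_covers_mem_of_notMem y hv]
      split_ifs <;> simp_all
  rw [Finset.sum_sub_distrib, sum_indicator_mem, sum_indicator_mem, finrank_top, hsup] at key
  rw [← key, Finset.sum_mul]
  refine Finset.sum_congr rfl fun x _ => ?_
  by_cases hc : y ⋖ x
  · obtain ⟨hle, hd⟩ := covBy_iff_finrank.1 hc
    rw [if_pos hc, one_mul, ← hd, ← sum_indicator_mem, ← sum_indicator_mem,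
      ← Finset.sum_sub_distrib]
    refine Finset.sum_congr rfl fun v _ => ?_
    have := @hle v
    by_cases h1 : v ∈ x.space <;> by_cases h2 : v ∈ y.space <;> simp_all
  · simp [hc]

open scoped Classical in
/-- Hyperplanes of `y` containing `U` are counted through the linear functionals on `y` vanishing
on `U`: each hyperplane is the kernel of `q - 1` functionals. -/
theorem sum_cocovers_ge [Fintype F] [FiniteDimensional F H] (y : AttenuatedSpace h)
    (U : Submodule F H) (hU : U ≤ y.space) :
    (∑ x : AttenuatedSpace h, if x ⋖ y ∧ U ≤ x.space then (1 : ℂ) else 0) *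
      ((Fintype.card F : ℂ) - 1) =
    (Fintype.card F : ℂ) ^ (finrank F y.space - finrank F U) - 1 := by
  have : Finite (Dual F y.space) := Module.finite_of_finite F
  let _ : Fintype (Dual F y.space) := Fintype.ofFinite _
  have hann : ∀ W : Submodule F H, W ≤ y.space →
      (∑ φ : Dual F y.space, if (∀ v : y.space, v.1 ∈ W → φ v = 0) then (1 : ℂ) else 0) =
        (Fintype.card F : ℂ) ^ (finrank F y.space - finrank F W) := by
    intro W hW
    have h1 := Subspace.finrank_add_finrank_dualAnnihilator_eq (W.comap y.space.subtype)
    have h2 : finrank F (W.comap y.space.subtype) = finrank F W :=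
      (Submodule.comapSubtypeEquivOfLe hW).finrank_eq
    rw [h2] at h1
    rw [show finrank F y.space - finrank F W =
      finrank F (W.comap y.space.subtype).dualAnnihilator by omega, ← sum_indicator_mem]
    refine Finset.sum_congr rfl fun φ _ => if_congr ?_ rfl rfl
    simp [mem_dualAnnihilator]
  have h0 : (∑ φ : Dual F y.space, if φ = 0 then (1 : ℂ) else 0) = 1 := by simp
  -- both sides count the nonzero functionals that vanish on `U`, on the left through their kernels
  have key : (∑ x : AttenuatedSpace h, ∑ φ : Dual F y.space,
      if φ ≠ 0 ∧ (x ⋖ y ∧ U ≤ x.space) ∧ (∀ v : y.space, v.1 ∈ x.space → φ v = 0) then (1 : ℂ) else 0) =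
      ∑ φ : Dual F y.space, ((if (∀ v : y.space, v.1 ∈ U → φ v = 0) then (1 : ℂ) else 0) -
        if φ = 0 then (1 : ℂ) else 0) := by
    rw [Finset.sum_comm]
    refine Finset.sum_congr rfl fun φ _ => ?_
    by_cases hφ : φ = 0
    · simp [hφ]
    -- the only hyperplane of `y` on which `φ` vanishes is its kernel
    have hker : finrank F ((LinearMap.ker φ).map y.space.subtype) + 1 = finrank F y.space := by
      rw [← Module.Dual.finrank_ker_add_one_of_ne_zero hφ]
      congr 1
      exact (Submodule.equivMapOfInjective _ y.space.injective_subtype _).finrank_eq.symm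
    have hmap : (LinearMap.ker φ).map y.space.subtype ≤ y.space := map_subtype_le _ _
    let z : AttenuatedSpace h := ofDisjoint ((LinearMap.ker φ).map y.space.subtype)
      (y.disjoint_space.mono_left hmap)
    have hmem : ∀ v : y.space, v.1 ∈ z.space ↔ φ v = 0 := by
      intro v
      simp [z]
    have hz : ∀ x : AttenuatedSpace h,
        (x ⋖ y ∧ U ≤ x.space) ∧ (∀ v : y.space, v.1 ∈ x.space → φ v = 0) ↔
        x = z ∧ (∀ v : y.space, v.1 ∈ U → φ v = 0) := by
      intro x
      constructor
      · rintro ⟨⟨hc, hUx⟩, hx⟩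
        obtain ⟨hle, hd⟩ := covBy_iff_finrank.1 hc
        refine ⟨space_injective (eq_of_le_of_finrank_eq ?_ ?_), fun v hv => hx v (hUx hv)⟩
        · exact fun w hw => (hmem ⟨w, hle hw⟩).2 (hx ⟨w, hle hw⟩ hw)
        · change _ = finrank F ((LinearMap.ker φ).map y.space.subtype)
          omega
      · rintro ⟨rfl, hx⟩
        exact ⟨⟨covBy_iff_finrank.2 ⟨hmap, hker.symm⟩,
          fun w hw => (hmem ⟨w, hU hw⟩).2 (hx ⟨w, hU hw⟩ hw)⟩, fun v hv => (hmem v).1 hv⟩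
    simp only [hz, hφ, ne_eq, not_false_eq_true, true_and, if_false, sub_zero, ite_and]
    simp
  rw [Finset.sum_sub_distrib, hann U hU, h0] at key
  rw [← key, Finset.sum_mul]
  refine Finset.sum_congr rfl fun x _ => ?_
  by_cases hc : x ⋖ y ∧ U ≤ x.space
  · obtain ⟨hle, hd⟩ := covBy_iff_finrank.1 hc.1
    have h1 := hann x.space hle
    rw [show finrank F y.space - finrank F x.space = 1 by omega, pow_one] at h1
    rw [if_pos hc, one_mul, ← h1, ← h0, ← Finset.sum_sub_distrib]
    refine Finset.sum_congr rfl fun φ _ => ?_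
    by_cases hφ : φ = 0 <;> simp [hφ, hc]
  · simp only [if_neg hc, zero_mul]
    exact (Finset.sum_eq_zero fun φ _ => if_neg fun h' => hc h'.2.1).symm

end AttenuatedSpace

/-! ### Level eigenvectors -/

namespace AttenuatedSpace

variable {F H : Type*} [Field F] [AddCommGroup H] [Module F H] {h : Submodule F H}

/-- The number of covers of an `i`-dimensional element of the poset, when `dim H = D` and
`dim h = M` over the field with `q` elements. -/
noncomputable def coverCount (q : ℂ) (D M i : ℕ) : ℂ :=
  (q ^ D - q ^ (i + M)) / (q ^ (i + 1) - q ^ i)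

/-- The `q`-analogue `(q ^ i - 1) / (q - 1)` of the number `i`; it counts the elements covered by an
`i`-dimensional element of the poset. -/
noncomputable def qNumber (q : ℂ) (i : ℕ) : ℂ :=
  (q ^ i - 1) / (q - 1)

open scoped Classical in
/-- The indicator function of the elements of the poset that contain the vector `v`. -/
noncomputable def indicator (h : Submodule F H) (v : H) (x : AttenuatedSpace h) : ℂ :=
  if v ∈ x.space then 1 else 0

theorem indicator_zero (x : AttenuatedSpace h) : indicator h 0 x = 1 := by
  simp [indicator]

section

variable [Fintype F] [FiniteDimensional F H]

variable (F) in
theorem one_lt_norm_card : 1 < ‖(Fintype.card F : ℂ)‖ := by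
  rw [Complex.norm_natCast]
  exact_mod_cast Fintype.one_lt_card

open scoped Classical in
theorem indicator_vecMul_raising (v : H) (y : AttenuatedSpace h) :
    (indicator h v ᵥ* raising h) y =
      coverCount (Fintype.card F) (finrank F H) (finrank F h) (finrank F y.space) *
        indicator h v y + if v ∈ y.space ⊔ h then 0 else 1 := by
  have hsum : (indicator h v ᵥ* raising h) y =
      ∑ x : AttenuatedSpace h, if y ⋖ x ∧ v ∈ x.space then (1 : ℂ) else 0 := by
    simp only [vecMul, dotProduct, indicator, raising, of_apply, ← ite_and, ite_mul, one_mul,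
      zero_mul, and_comm]
  rw [hsum]
  by_cases hv : v ∈ y.space
  · have hvh : v ∈ y.space ⊔ h := mem_sup_left hv
    have hne : (Fintype.card F : ℂ) ^ (finrank F y.space + 1) -
        (Fintype.card F : ℂ) ^ finrank F y.space ≠ 0 := by
      have h1 := one_lt_norm_card F
      have h0 : (Fintype.card F : ℂ) ≠ 0 := fun e => by simp [e] at h1; linarith
      have h2 : (Fintype.card F : ℂ) ≠ 1 := fun e => by simp [e] at h1
      rw [pow_succ, ← mul_sub_one]
      exact mul_ne_zero (pow_ne_zero _ h0) (sub_ne_zero.2 h2)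
    rw [indicator, if_pos hv, if_pos hvh, mul_one, add_zero, coverCount, eq_div_iff hne,
      ← sum_covers]
    congr 1
    refine Finset.sum_congr rfl fun x _ => if_congr ?_ rfl rfl
    exact and_iff_left_of_imp fun hc => (covBy_iff_finrank.1 hc).1 hv
  · rw [sum_covers_mem_of_notMem y hv, indicator, if_neg hv, mul_zero, zero_add]

open scoped Classical in
theorem indicator_vecMul_lowering (v : H) (y : AttenuatedSpace h) :
    (indicator h v ᵥ* lowering h) y =
      qNumber (Fintype.card F) (finrank F y.space - finrank F (span F {v})) * indicator h v y := by
  have hsum : (indicator h v ᵥ* lowering h) y =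
      ∑ x : AttenuatedSpace h, if x ⋖ y ∧ span F {v} ≤ x.space then (1 : ℂ) else 0 := by
    simp only [vecMul, dotProduct, indicator, lowering, of_apply, ← ite_and, ite_mul, one_mul,
      zero_mul, and_comm, span_singleton_le_iff_mem]
  rw [hsum]
  by_cases hv : v ∈ y.space
  · have h2 : (Fintype.card F : ℂ) ≠ 1 := fun e => by simpa [e] using one_lt_norm_card F
    rw [indicator, if_pos hv, mul_one, qNumber, eq_div_iff (sub_ne_zero.2 h2),
      sum_cocovers_ge y _ (by simpa using hv)]
  · rw [indicator, if_neg hv, mul_zero]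
    refine Finset.sum_eq_zero fun x _ => if_neg ?_
    rintro ⟨hc, hx⟩
    exact hv ((covBy_iff_finrank.1 hc).1 (hx (mem_span_singleton_self v)))

/-- The function `f` on the poset spans, together with its restrictions to the levels, a space of
row vectors that is stable under right multiplication by the raising and lowering matrices; on the
part of dimension `i` the two matrices act by the scalars `n i` and `m i`. -/
structure IsLevelEigenvector (f : AttenuatedSpace h → ℂ) (n m : ℕ → ℂ) : Prop where
  vecMul_raising : ∀ y, (f ᵥ* raising h) y = n (finrank F y.space) * f y
  vecMul_lowering : ∀ y, (f ᵥ* lowering h) y = m (finrank F y.space) * f y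

theorem isLevelEigenvector_one :
    IsLevelEigenvector (h := h) (fun _ => 1)
      (coverCount (Fintype.card F) (finrank F H) (finrank F h)) (qNumber (Fintype.card F)) := by
  have h1 : (fun _ => 1) = indicator h 0 := funext fun x => (indicator_zero x).symm
  rw [h1]
  refine ⟨fun y => ?_, fun y => ?_⟩
  · simp [indicator_vecMul_raising]
  · have h0 : finrank F (span F {(0 : H)}) = 0 := by rw [span_zero_singleton, finrank_bot]
    rw [indicator_vecMul_lowering, h0, Nat.sub_zero]

/-- The inhomogeneous term in `indicator_vecMul_raising` depends only on the coset of the vector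
modulo `h`, so it cancels for two vectors in one coset. -/
theorem isLevelEigenvector_indicator_sub {v k : H} (hv : v ∉ h) (hk : k ∈ h) :
    IsLevelEigenvector (indicator h v - indicator h (v + k))
      (coverCount (Fintype.card F) (finrank F H) (finrank F h))
      (fun i => qNumber (Fintype.card F) (i - 1)) := by
  have hv0 : v ≠ 0 := fun e => hv (e ▸ h.zero_mem)
  have hvk0 : v + k ≠ 0 := fun e => hv (by simpa [eq_neg_of_add_eq_zero_left e] using hk)
  refine ⟨fun y => ?_, fun y => ?_⟩
  · have hiff : v + k ∈ y.space ⊔ h ↔ v ∈ y.space ⊔ h :=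
      add_mem_cancel_right (mem_sup_right hk)
    rw [sub_vecMul, Pi.sub_apply, indicator_vecMul_raising, indicator_vecMul_raising,
      Pi.sub_apply]
    by_cases hvy : v ∈ y.space ⊔ h
    · rw [if_pos hvy, if_pos (hiff.2 hvy)]
      ring
    · rw [if_neg hvy, if_neg (hiff.not.2 hvy)]
      ring
  · rw [sub_vecMul, Pi.sub_apply, indicator_vecMul_lowering, indicator_vecMul_lowering,
      Pi.sub_apply, finrank_span_singleton hv0, finrank_span_singleton hvk0]
    ring

open scoped Classical in
/-- The indicator function of the elements `x` of the poset with `v ∈ x + h`. -/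
noncomputable def cosetIndicator (h : Submodule F H) (v : H) (x : AttenuatedSpace h) : ℂ :=
  if v ∈ x.space ⊔ h then 1 else 0

omit [Fintype F] [FiniteDimensional F H] in
/-- If `v ∈ x + h`, then exactly one vector of the coset `v + h` lies in `x`. -/
theorem cosetIndicator_eq_sum [Fintype h] (v : H) :
    cosetIndicator h v = ∑ k : h, indicator h (v + k) := by
  classical
  funext x
  rw [Finset.sum_apply, cosetIndicator]
  split_ifs with hv
  · obtain ⟨a, ha, b, hb, rfl⟩ := mem_sup.1 hv
    rw [Finset.sum_eq_single (⟨-b, neg_mem hb⟩ : h)]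
    · simp [indicator, ha]
    · rintro ⟨k, hk⟩ - hne
      refine if_neg fun hmem => hne ?_
      have h1 : b + k ∈ x.space ⊓ h :=
        ⟨by simpa [add_assoc] using sub_mem hmem ha, add_mem hb hk⟩
      rw [x.space_inf, mem_bot] at h1
      exact Subtype.ext (eq_neg_of_add_eq_zero_right h1)
    · simp
  · refine (Finset.sum_eq_zero fun k _ => if_neg fun hmem => hv ?_).symm
    exact (add_mem_cancel_right (mem_sup_right k.2)).1 (mem_sup_left hmem)

theorem cosetIndicator_vecMul_raising (v : H) (y : AttenuatedSpace h) :
    (cosetIndicator h v ᵥ* raising h) y =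
      (coverCount (Fintype.card F) (finrank F H) (finrank F h) (finrank F y.space) -
        (Fintype.card F : ℂ) ^ finrank F h) * cosetIndicator h v y +
      (Fintype.card F : ℂ) ^ finrank F h := by
  classical
  have : Finite h := Module.finite_of_finite F
  let _ : Fintype h := Fintype.ofFinite h
  have hiff : ∀ k : h, v + k ∈ y.space ⊔ h ↔ v ∈ y.space ⊔ h := fun k =>
    add_mem_cancel_right (mem_sup_right k.2)
  rw [cosetIndicator_eq_sum, sum_vecMul, Finset.sum_apply]
  simp only [indicator_vecMul_raising, hiff]
  rw [Finset.sum_add_distrib, ← Finset.mul_sum, ← Finset.sum_apply y, ← cosetIndicator_eq_sum,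
    Finset.sum_const, Finset.card_univ, Module.card_eq_pow_finrank (K := F) (V := h), cosetIndicator]
  split_ifs <;> simp

theorem cosetIndicator_vecMul_lowering {v : H} (hv : v ∉ h) (y : AttenuatedSpace h) :
    (cosetIndicator h v ᵥ* lowering h) y =
      qNumber (Fintype.card F) (finrank F y.space - 1) * cosetIndicator h v y := by
  have : Finite h := Module.finite_of_finite F
  let _ : Fintype h := Fintype.ofFinite h
  have hne : ∀ k : h, v + k ≠ 0 := fun k e => hv (by simp [eq_neg_of_add_eq_zero_left e])
  rw [cosetIndicator_eq_sum, sum_vecMul, Finset.sum_apply]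
  simp only [indicator_vecMul_lowering, finrank_span_singleton (hne _)]
  rw [← Finset.mul_sum, Finset.sum_apply]

/-- The inhomogeneous term `q ^ dim h` in `cosetIndicator_vecMul_raising` is the same for both
cosets, so it cancels. -/
theorem isLevelEigenvector_cosetIndicator_sub {v w : H} (hv : v ∉ h) (hw : w ∉ h) :
    IsLevelEigenvector (cosetIndicator h v - cosetIndicator h w)
      (fun i => coverCount (Fintype.card F) (finrank F H) (finrank F h) i -
        (Fintype.card F : ℂ) ^ finrank F h)
      (fun i => qNumber (Fintype.card F) (i - 1)) := by
  refine ⟨fun y => ?_, fun y => ?_⟩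
  · rw [sub_vecMul, Pi.sub_apply, cosetIndicator_vecMul_raising, cosetIndicator_vecMul_raising,
      Pi.sub_apply]
    ring
  · rw [sub_vecMul, Pi.sub_apply, cosetIndicator_vecMul_lowering hv,
      cosetIndicator_vecMul_lowering hw, Pi.sub_apply]
    ring

omit [Fintype F] in
/-- The vectors `v`, `w` and `0 ≠ k ∈ h` are chosen so that the level eigenvectors
`indicator h v - indicator h (v + k)` and `cosetIndicator h v - cosetIndicator h w` do not vanish on
the levels from `1` to `N` and from `1` to `N - 1`, respectively. -/
theorem exists_vectors {N M : ℕ} (hN : 2 ≤ N) (hM : 1 ≤ M) (hH : finrank F H = N + M)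
    (hh : finrank F h = M) :
    ∃ v w k : H, v ∉ h ∧ w ∉ h ∧ k ∈ h ∧
      (∀ i, 1 ≤ i → i ≤ N → ∃ y : AttenuatedSpace h, finrank F y.space = i ∧
        (indicator h v - indicator h (v + k)) y ≠ 0) ∧
      (∀ i, 1 ≤ i → i + 1 ≤ N → ∃ y : AttenuatedSpace h, finrank F y.space = i ∧
        (cosetIndicator h v - cosetIndicator h w) y ≠ 0) := by
  have hne : h ≠ ⊥ := fun e => by
    rw [e, finrank_bot] at hh
    omega
  obtain ⟨k, hk, hk0⟩ := exists_mem_ne_zero_of_ne_bot hne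
  have h1 : h ≠ ⊤ := fun e => by
    rw [e, finrank_top] at hh
    omega
  obtain ⟨w, -, hw⟩ := SetLike.exists_of_lt h1.lt_top
  have hrK : finrank F ↥(h ⊔ span F {w}) = M + 1 := by rw [finrank_sup_span_singleton hw, hh]
  have h2 : h ⊔ span F {w} ≠ ⊤ := fun e => by
    rw [e, finrank_top] at hrK
    omega
  obtain ⟨v, -, hv⟩ := SetLike.exists_of_lt h2.lt_top
  have hvh : v ∉ h := fun hvh => hv (mem_sup_left hvh)
  have hv0 : v ≠ 0 := fun e => hvh (e ▸ h.zero_mem)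
  refine ⟨v, w, k, hvh, hw, hk, fun i hi hiN => ?_, fun i hi hiN => ?_⟩
  · obtain ⟨y, hvy, hyh, hy⟩ := exists_disjoint_finrank_eq (U := span F {v}) (K := h) (i := i)
      (disjoint_span_singleton' hv0 |>.2 hvh).symm (by rwa [finrank_span_singleton hv0])
      (by omega)
    rw [span_singleton_le_iff_mem] at hvy
    refine ⟨ofDisjoint y hyh, hy, ?_⟩
    have hnot : v + k ∉ y := fun hmem => hk0 (disjoint_def.1 hyh k
      (by simpa using sub_mem hmem hvy) hk)
    simp [indicator, hvy, hnot]
  · obtain ⟨y, hvy, hyK, hy⟩ := exists_disjoint_finrank_eq (U := span F {v})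
      (K := h ⊔ span F {w}) (i := i)
      (disjoint_span_singleton' hv0 |>.2 hv).symm (by rwa [finrank_span_singleton hv0])
      (by omega)
    rw [span_singleton_le_iff_mem] at hvy
    refine ⟨ofDisjoint y (hyK.mono_right le_sup_left), hy, ?_⟩
    have hnot : w ∉ y ⊔ h := fun hmem => by
      obtain ⟨a, ha, b, hb, rfl⟩ := mem_sup.1 hmem
      have : a = 0 := disjoint_def.1 hyK a ha (by
        have := sub_mem (mem_sup_right (mem_span_singleton_self (a + b)) : a + b ∈ h ⊔ span F {a + b})
          (mem_sup_left hb : b ∈ h ⊔ span F {a + b})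
        simpa using this)
      rw [this, zero_add] at hw
      exact hw hb
    simp [cosetIndicator, mem_sup_left hvy, hnot]

omit [Fintype F] in
theorem exists_finrank_eq {N M : ℕ} (hH : finrank F H = N + M) (hh : finrank F h = M)
    {i : ℕ} (hi : i ≤ N) : ∃ y : AttenuatedSpace h, finrank F y.space = i := by
  obtain ⟨y, -, hyh, hy⟩ := exists_disjoint_finrank_eq (U := (⊥ : Submodule F H)) (K := h) (i := i)
    disjoint_bot_left (by simp) (by omega)
  exact ⟨ofDisjoint y hyh, hy⟩

omit [Fintype F] in
theorem finrank_space_le {N M : ℕ} (hH : finrank F H = N + M) (hh : finrank F h = M)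
    (y : AttenuatedSpace h) : finrank F y.space ≤ N := by
  have h1 := finrank_sup_add_finrank_inf_eq y.space h
  have h2 := finrank_le (y.space ⊔ h)
  rw [y.space_inf, finrank_bot] at h1
  omega

end

end AttenuatedSpace

/-! ### The tridiagonal relation on a level eigenvector -/

/-- The commutator expanded in words; the terms `β • (X * Y * X)` and `Y * X ^ 2` combine to the
coefficient `β + 1`. -/
theorem tridiagonalElement_eq {T : Type*} [Ring T] [Algebra ℂ T] (β γ ϱ : ℂ) (X Y : T) :
    tridiagonalElement β γ ϱ X Y =
      X * X * X * Y - (β + 1) • (X * X * Y * X) + (β + 1) • (X * Y * X * X) - Y * X * X * X -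
        γ • (X * X * Y - Y * X * X) - ϱ • (X * Y - Y * X) := by
  simp only [tridiagonalElement, Ring.lie_def, pow_two, mul_sub, sub_mul, mul_add, add_mul,
    mul_smul_comm, smul_mul_assoc, mul_assoc, add_smul, one_smul, smul_sub, smul_add]
  abel

/-- The action of `A` on the coefficients of row vectors that are constant multiples of a level
eigenvector on each level: `r` comes from the raising part of `A` and `θ` from the diagonal part. -/
def raiseOp (r θ a : ℕ → ℂ) (i : ℕ) : ℂ := r i * a (i + 1) + θ i * a i

/-- The action of `A*` on the coefficients, with `l` from the lowering part and `θ'` from the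
diagonal part. The value `a (i - 1)` at `i = 0` is harmless, since `l 0 = 0` wherever this is
used. -/
def lowerOp (l θ' a : ℕ → ℂ) (i : ℕ) : ℂ := l i * a (i - 1) + θ' i * a i

/-- The tridiagonal relation, transported to the coefficients. -/
def tridiagonalOp (β γ ϱ : ℂ) (R L : (ℕ → ℂ) → ℕ → ℂ) (a : ℕ → ℂ) (i : ℕ) : ℂ :=
  L (R (R (R a))) i - (β + 1) * R (L (R (R a))) i + (β + 1) * R (R (L (R a))) i -
    R (R (R (L a))) i - γ * (L (R (R a)) i - R (R (L a)) i) - ϱ * (L (R a) i - R (L a) i)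

namespace AttenuatedSpace

variable {F H : Type*} [Field F] [AddCommGroup H] [Module F H] {h : Submodule F H}

/-- The function that is `a i` times `f` on the elements of dimension `i`. -/
noncomputable def levelVec (f : AttenuatedSpace h → ℂ) (a : ℕ → ℂ) (x : AttenuatedSpace h) : ℂ :=
  a (finrank F x.space) * f x

variable [Fintype F] [FiniteDimensional F H]

theorem levelVec_vecMul_matA {f : AttenuatedSpace h → ℂ} {n m : ℕ → ℂ}
    (hf : IsLevelEigenvector f n m) {N : ℕ} (hN : ∀ y : AttenuatedSpace h, finrank F y.space ≤ N)
    (α θ a : ℕ → ℂ) :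
    levelVec f a ᵥ* matA h N α θ =
      levelVec f (raiseOp (fun i => if i < N then α i * n i else 0) θ a) := by
  classical
  funext y
  have hR : (levelVec f a ᵥ* raising h) y =
      a (finrank F y.space + 1) * (n (finrank F y.space) * f y) := by
    rw [← hf.vecMul_raising y]
    simp only [vecMul, dotProduct, raising, of_apply, levelVec, Finset.mul_sum]
    refine Finset.sum_congr rfl fun x _ => ?_
    by_cases hc : y ⋖ x
    · simp [hc, (covBy_iff_finrank.1 hc).2]
    · simp [hc]
  have hproj : ∀ (u : AttenuatedSpace h → ℂ) (i : ℕ), (u ᵥ* proj h i) y =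
      if finrank F y.space = i then u y else 0 := by
    intro u i
    rw [proj, vecMul_diagonal]
    change u y * (if finrank F y.space = i then 1 else 0) = _
    simp
  simp only [matA, vecMul_add, vecMul_sum, vecMul_smul, ← vecMul_vecMul, Pi.add_apply,
    Finset.sum_apply, Pi.smul_apply, hproj, hR, smul_eq_mul, mul_ite, mul_zero,
    Finset.sum_ite_eq, Finset.mem_range, levelVec, raiseOp]
  rw [if_pos (Nat.lt_succ_of_le (hN y))]
  split_ifs <;> ring

theorem levelVec_vecMul_matAStar {f : AttenuatedSpace h → ℂ} {n m : ℕ → ℂ}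
    (hf : IsLevelEigenvector f n m) {N : ℕ} (hN : ∀ y : AttenuatedSpace h, finrank F y.space ≤ N)
    (α' θ' a : ℕ → ℂ) :
    levelVec f a ᵥ* matAStar h N α' θ' =
      levelVec f (lowerOp (fun i => if 1 ≤ i then α' i * m i else 0) θ' a) := by
  classical
  funext y
  have hL : (levelVec f a ᵥ* lowering h) y =
      a (finrank F y.space - 1) * (m (finrank F y.space) * f y) := by
    rw [← hf.vecMul_lowering y]
    simp only [vecMul, dotProduct, lowering, of_apply, levelVec, Finset.mul_sum]
    refine Finset.sum_congr rfl fun x _ => ?_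
    by_cases hc : x ⋖ y
    · simp [hc, (covBy_iff_finrank.1 hc).2]
    · simp [hc]
  have hproj : ∀ (u : AttenuatedSpace h → ℂ) (i : ℕ), (u ᵥ* proj h i) y =
      if finrank F y.space = i then u y else 0 := by
    intro u i
    rw [proj, vecMul_diagonal]
    change u y * (if finrank F y.space = i then 1 else 0) = _
    simp
  simp only [matAStar, vecMul_add, vecMul_sum, vecMul_smul, ← vecMul_vecMul, Pi.add_apply,
    Finset.sum_apply, Pi.smul_apply, hproj, hL, smul_eq_mul, mul_ite, mul_zero,
    Finset.sum_ite_eq, Finset.mem_range, Finset.mem_Icc, hN y, and_true, levelVec, lowerOp]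
  rw [if_pos (Nat.lt_succ_of_le (hN y))]
  split_ifs <;> ring

/-- A level eigenvector turns the tridiagonal relation of matrices into one of coefficients. -/
theorem tridiagonalOp_eq_zero {f : AttenuatedSpace h → ℂ} {n m : ℕ → ℂ}
    (hf : IsLevelEigenvector f n m) {N : ℕ} (hN : ∀ y : AttenuatedSpace h, finrank F y.space ≤ N)
    {α α' θ θ' : ℕ → ℂ} {β γ ϱ : ℂ}
    (hT : tridiagonalElement β γ ϱ (matA h N α θ) (matAStar h N α' θ') = 0)
    {y : AttenuatedSpace h} (hy : f y ≠ 0) (a : ℕ → ℂ) :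
    tridiagonalOp β γ ϱ (raiseOp (fun i => if i < N then α i * n i else 0) θ)
      (lowerOp (fun i => if 1 ≤ i then α' i * m i else 0) θ') a (finrank F y.space) = 0 := by
  have h1 : (levelVec f a ᵥ*
      tridiagonalElement β γ ϱ (matA h N α θ) (matAStar h N α' θ')) y = 0 := by
    rw [hT, vecMul_zero, Pi.zero_apply]
  simp only [tridiagonalElement_eq, vecMul_add, vecMul_sub, vecMul_smul, ← vecMul_vecMul,
    levelVec_vecMul_matA hf hN, levelVec_vecMul_matAStar hf hN, Pi.add_apply, Pi.sub_apply,
    Pi.smul_apply, smul_eq_mul, levelVec] at h1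
  refine (mul_eq_zero.1 ?_).resolve_right hy
  rw [tridiagonalOp]
  linear_combination h1

end AttenuatedSpace

/-! ### Homogeneous components of the tridiagonal relation -/

/-- The component of degree `-1`. -/
theorem tridiagonalOp_single_pred (β γ ϱ : ℂ) (r l θ θ' : ℕ → ℂ) (j : ℕ) :
    tridiagonalOp β γ ϱ (raiseOp r θ) (lowerOp l θ') (Pi.single j 1) (j + 1) =
      l (j + 1) * (θ j - θ (j + 1)) *
        (θ j ^ 2 - β * θ j * θ (j + 1) + θ (j + 1) ^ 2 - γ * (θ j + θ (j + 1)) - ϱ) := by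
  have hp1 : j + 2 ≠ j := by omega
  have hp2 : j + 3 ≠ j := by omega
  have hp3 : j + 4 ≠ j := by omega
  simp only [tridiagonalOp, raiseOp, lowerOp, Pi.single_apply, add_assoc, Nat.reduceAdd,
    Nat.add_one_sub_one, hp1, hp2, hp3, Nat.add_eq_left,
    one_ne_zero, if_false, if_true]
  ring

/-- The component of degree `3`. -/
theorem tridiagonalOp_single_add_three (β γ ϱ : ℂ) (r l θ θ' : ℕ → ℂ) (i : ℕ) (hl : l 0 = 0) :
    tridiagonalOp β γ ϱ (raiseOp r θ) (lowerOp l θ') (Pi.single (i + 3) 1) i =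
      r i * r (i + 1) * r (i + 2) *
        (θ' i - (β + 1) * θ' (i + 1) + (β + 1) * θ' (i + 2) - θ' (i + 3)) := by
  rcases i with _ | j
  · simp [tridiagonalOp, raiseOp, lowerOp, hl]
    ring
  · simp [tridiagonalOp, raiseOp, lowerOp, add_assoc]
    ring

/-- The component of degree `2`; the recurrence for `θ` turns the terms in `θ` and `θ'` into
products of differences. -/
theorem tridiagonalOp_single_add_two (β γ ϱ : ℂ) (r l θ θ' : ℕ → ℂ) (i : ℕ) (hl : l 0 = 0)
    (hγ : θ i + θ (i + 2) - β * θ (i + 1) = γ) :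
    tridiagonalOp β γ ϱ (raiseOp r θ) (lowerOp l θ') (Pi.single (i + 2) 1) i =
      r i * r (i + 1) * (l i * r (i - 1) - (β + 1) * (l (i + 1) * r i) +
        (β + 1) * (l (i + 2) * r (i + 1)) - l (i + 3) * r (i + 2) - (β + 1) *
        ((θ (i + 1) - θ i) * (θ' (i + 1) - θ' i) -
          (θ (i + 2) - θ (i + 1)) * (θ' (i + 2) - θ' (i + 1)))) := by
  subst hγ
  rcases i with _ | j
  · simp [tridiagonalOp, raiseOp, lowerOp, hl]
    ring
  · simp [tridiagonalOp, raiseOp, lowerOp, add_assoc]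
    ring

/-! ### Recurrences -/

/-- The third-order difference operator `(1 - S)(1 - β S + S ^ 2)`, where `S` is the shift. -/
def thirdDiff (β : ℂ) (u : ℕ → ℂ) (j : ℕ) : ℂ :=
  u j - (β + 1) * u (j + 1) + (β + 1) * u (j + 2) - u (j + 3)

theorem pow_ne_one_of_one_lt_norm {q : ℂ} (hq : 1 < ‖q‖) {n : ℕ} (hn : n ≠ 0) : q ^ n ≠ 1 := by
  intro e
  have h1 := one_lt_pow₀ hq hn
  rw [← norm_pow, e, norm_one] at h1
  exact lt_irrefl _ h1

/-- The characteristic roots of `thirdDiff β` are `1`, `t` and `t⁻¹` when `β = t + t⁻¹`. -/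
theorem exists_eq_add_pow_of_thirdDiff_eq_zero {β t : ℂ} (ht0 : t ≠ 0) (ht : t ^ 2 ≠ 1)
    (hβ : β * t = t ^ 2 + 1) {N : ℕ} {u : ℕ → ℂ}
    (hu : ∀ j, j + 3 ≤ N → thirdDiff β u j = 0) :
    ∃ a b c : ℂ, ∀ i ≤ N, u i = a + b * t ^ i + c * (t ^ i)⁻¹ := by
  have ht1 : t - 1 ≠ 0 := fun e => ht (by linear_combination (t + 1) * e)
  have ht2 : t ^ 2 - 1 ≠ 0 := sub_ne_zero.2 ht
  obtain rfl : β = t + t⁻¹ := by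
    field_simp
    linear_combination hβ
  -- `b` and `c` are found from the first two differences of `u`
  obtain ⟨b, hb⟩ : ∃ b, b = (t * (u 2 - u 1) - (u 1 - u 0)) / ((t - 1) * (t ^ 2 - 1)) := ⟨_, rfl⟩
  obtain ⟨c, hc⟩ : ∃ c, c = t ^ 2 * ((u 2 - u 1) - t * (u 1 - u 0)) / ((t - 1) * (t ^ 2 - 1)) :=
    ⟨_, rfl⟩
  refine ⟨u 0 - b - c, b, c, fun i => ?_⟩
  induction i using Nat.strong_induction_on with
  | _ i ih =>
    intro hi
    rcases i with _ | _ | _ | j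
    · simp only [pow_zero, inv_one, mul_one]
      ring
    · subst hb hc
      field_simp
      ring
    · subst hb hc
      field_simp
      ring
    · have h0 := ih j (by omega) (by omega)
      have h1 := ih (j + 1) (by omega) (by omega)
      have h2 := ih (j + 2) (by omega) (by omega)
      have h3 := hu j (by omega)
      rw [thirdDiff, h0, h1, h2] at h3
      have htj : t ^ j ≠ 0 := pow_ne_zero _ ht0
      have e : u (j + 1 + 1 + 1) = u (j + 3) := rfl
      rw [e, ← sub_eq_zero, ← neg_eq_zero, ← h3]
      simp only [pow_succ, mul_inv]
      field_simp
      ring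

/-- The weights `q ^ N - q ^ i` and `q ^ i - 1` add up to a constant, which gives the first
relation. Eliminating `ξ (j + 3)` gives the second one, which also holds at the top end
`j + 3 = N`, where the weight `q ^ N - q ^ N` removes `ξ N`. -/
theorem thirdDiff_eq_zero_of_weighted {q β : ℂ} (hq : 1 < ‖q‖) {N : ℕ}
    {ξ : ℕ → ℂ} (hN : 1 ≤ N)
    (h1 : ∀ j, j + 3 ≤ N → thirdDiff β (fun i => ξ i * (q ^ N - q ^ i)) j = 0)
    (h2 : ∀ j, j + 4 ≤ N → thirdDiff β (fun i => ξ i * (q ^ i - 1)) j = 0) :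
    (∀ j, j + 4 ≤ N → thirdDiff β ξ j = 0) ∧
    ∀ j, j + 3 ≤ N →
      (q ^ 2 + q + 1) * ξ j = (β + 1) * q * ((q + 1) * ξ (j + 1) - q * ξ (j + 2)) := by
  have hq0 : q ≠ 0 := fun e => by simp [e] at hq; linarith
  have hq1 : q - 1 ≠ 0 := sub_ne_zero.2 fun e => by simp [e] at hq
  have key : ∀ j, j + 4 ≤ N → thirdDiff β ξ j = 0 := by
    intro j hj
    have hqN : q ^ N - 1 ≠ 0 := sub_ne_zero.2 (pow_ne_one_of_one_lt_norm hq (by omega))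
    refine (mul_eq_zero.1 ?_).resolve_left hqN
    have e1 := h1 j (by omega)
    have e2 := h2 j hj
    simp only [thirdDiff] at e1 e2 ⊢
    linear_combination e1 + e2
  refine ⟨key, fun j hj => ?_⟩
  have hqj : q ^ j * (q - 1) ≠ 0 := mul_ne_zero (pow_ne_zero _ hq0) hq1
  rw [← sub_eq_zero]
  refine (mul_eq_zero.1 ?_).resolve_left hqj
  rcases hj.lt_or_eq with hj' | hj'
  · have e1 := key j hj'
    have e2 := h2 j hj'
    simp only [thirdDiff, pow_succ] at e1 e2
    linear_combination (q ^ j * q ^ 3 - 1) * e1 - e2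
  · have e1 := h1 j hj
    subst hj'
    simp only [thirdDiff, pow_succ] at e1
    linear_combination e1

/-- A sequence subject to both relations either forces `β = q + q⁻¹`, or is geometric with ratio a
square root `t` of `q⁻¹`, with `β = t + t⁻¹`. -/
theorem eq_add_inv_or_geometric {q β : ℂ} (hq : 1 < ‖q‖) {N : ℕ} (hN : 6 ≤ N)
    {ξ : ℕ → ℂ} (hξ : ∀ i < N, ξ i ≠ 0)
    (h1 : ∀ j, j + 4 ≤ N → thirdDiff β ξ j = 0)
    (h2 : ∀ j, j + 3 ≤ N →
      (q ^ 2 + q + 1) * ξ j = (β + 1) * q * ((q + 1) * ξ (j + 1) - q * ξ (j + 2))) :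
    β * q = q ^ 2 + 1 ∨
      ∃ t : ℂ, q * t ^ 2 = 1 ∧ β * t = t ^ 2 + 1 ∧ ∀ i ≤ 5, ξ i = ξ 0 * t ^ i := by
  have hq0 : q ≠ 0 := fun e => by simp [e] at hq; linarith
  have hq1 : q - 1 ≠ 0 := sub_ne_zero.2 fun e => by simp [e] at hq
  have hs : q ^ 2 + q + 1 ≠ 0 := fun e =>
    pow_ne_one_of_one_lt_norm hq (n := 3) (by norm_num) (by linear_combination (q - 1) * e)
  have hqp1 : q + 1 ≠ 0 := fun e =>
    pow_ne_one_of_one_lt_norm hq (n := 2) (by norm_num) (by linear_combination (q - 1) * e)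
  obtain ⟨B, rfl⟩ : ∃ B, β = B - 1 := ⟨β + 1, by ring⟩
  simp only [thirdDiff, sub_add_cancel] at h1 h2
  have hB : B ≠ 0 := fun e => by
    have := h2 0 (by omega)
    rw [e] at this
    exact mul_ne_zero hs (hξ 0 (by omega)) (by linear_combination this)
  -- the second relation as a recurrence `ξ (j + 2) = p * ξ (j + 1) - v * ξ j`
  obtain ⟨p, hp⟩ : ∃ p, p = (q + 1) / q := ⟨_, rfl⟩
  obtain ⟨v, hv⟩ : ∃ v, v = (q ^ 2 + q + 1) / (B * q ^ 2) := ⟨_, rfl⟩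
  have hqp : q * p = q + 1 := by rw [hp]; field_simp
  have hqv : B * q ^ 2 * v = q ^ 2 + q + 1 := by rw [hv]; field_simp
  have hrec : ∀ j, j + 3 ≤ N → ξ (j + 2) = p * ξ (j + 1) - v * ξ j := by
    intro j hj
    have := h2 j hj
    rw [hp, hv]
    field_simp
    linear_combination this
  -- the first relation modulo that recurrence
  have hrem : ∀ j, j + 4 ≤ N →
      (p * (p - B) + B - v) * ξ (j + 1) = (v * (p - B) + 1) * ξ j := by
    intro j hj
    have e0 := h1 j hj
    have e1 := hrec j (by omega)
    have e2 : ξ (j + 3) = p * ξ (j + 2) - v * ξ (j + 1) := hrec (j + 1) (by omega)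
    linear_combination -e0 - e2 - (p - B) * e1
  have hξ0 := hξ 0 (by omega)
  have of_v : q * v = 1 → (B - 1) * q = q ^ 2 + 1 := fun e => by
    linear_combination hqv - B * q * e
  by_cases hm : p * (p - B) + B - v = 0
  · left
    have hn : v * (p - B) + 1 = 0 := by
      have := hrem 0 (by omega)
      rw [hm, zero_mul] at this
      exact (mul_eq_zero.1 this.symm).resolve_right hξ0
    refine of_v (mul_left_cancel₀ hqp1 ?_)
    linear_combination (-q * v) * hqp + q ^ 2 * hn + hqv
  · obtain ⟨t, ht⟩ : ∃ t, t = (v * (p - B) + 1) / (p * (p - B) + B - v) := ⟨_, rfl⟩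
    have hstep : ∀ j, j + 4 ≤ N → ξ (j + 1) = t * ξ j := by
      intro j hj
      rw [ht]
      field_simp
      linear_combination hrem j hj
    have e1 : ξ 1 = t * ξ 0 := hstep 0 (by omega)
    have e2 : ξ 2 = t * ξ 1 := hstep 1 (by omega)
    have e3 : ξ 3 = t * ξ 2 := hstep 2 (by omega)
    have r2 : ξ 2 = p * ξ 1 - v * ξ 0 := hrec 0 (by omega)
    have r4 : ξ 4 = p * ξ 3 - v * ξ 2 := hrec 2 (by omega)
    have r5 : ξ 5 = p * ξ 4 - v * ξ 3 := hrec 3 (by omega)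
    have ht0 : t ≠ 0 := fun e => hξ 1 (by omega) (by rw [e1, e, zero_mul])
    have hquad : t ^ 2 = p * t - v := by
      refine mul_right_cancel₀ hξ0 ?_
      rw [e2, e1] at r2
      linear_combination r2
    have hcub : (t - 1) * (t ^ 2 - (B - 1) * t + 1) = 0 := by
      refine (mul_eq_zero.1 ?_).resolve_right hξ0
      have := h1 0 (by omega)
      simp only [zero_add] at this
      rw [e3, e2, e1] at this
      linear_combination -this
    rcases mul_eq_zero.1 hcub with h | h
    · left
      refine of_v ?_
      linear_combination q * hquad + t * hqp - (q * t - 1) * h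
    · have hfac : (q * t - 1) * (q * t ^ 2 - 1) = 0 := by
        have h3 : q * v = (q + 1) * t - q * t ^ 2 := by linear_combination q * hquad + t * hqp
        have h4 : B * t = t ^ 2 + t + 1 := by linear_combination -h
        have h5 : t * ((q * t - 1) * (q * t ^ 2 - 1)) = 0 := by
          linear_combination -t * hqv + q ^ 2 * v * h4 + q * (t ^ 2 + t + 1) * h3
        exact (mul_eq_zero.1 h5).resolve_left ht0
      rcases mul_eq_zero.1 hfac with h' | h'
      · left
        refine of_v ?_
        linear_combination q * hquad + t * hqp - (t - 1) * h'
      · right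
        refine ⟨t, by linear_combination h', by linear_combination -h, ?_⟩
        have e4 : ξ 4 = t ^ 4 * ξ 0 := by
          rw [e2] at e3
          rw [r4, e3, e2, e1]
          linear_combination -t ^ 2 * ξ 0 * hquad
        have e5 : ξ 5 = t ^ 5 * ξ 0 := by
          rw [r5, e4, e3, e2, e1]
          linear_combination -t ^ 3 * ξ 0 * hquad
        intro i hi
        interval_cases i
        · simp
        · rw [e1]; ring
        · rw [e2, e1]; ring
        · rw [e3, e2, e1]; ring
        · rw [e4]; ring
        · rw [e5]; ring

/-! ### The components for the three level eigenvectors -/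

/-- The product of the forward differences of two sequences. -/
def diffMulDiff (u w : ℕ → ℂ) (i : ℕ) : ℂ := (u (i + 1) - u i) * (w (i + 1) - w i)

namespace AttenuatedSpace

theorem qNumber_ne_zero {q : ℂ} (hq : 1 < ‖q‖) {i : ℕ} (hi : i ≠ 0) : qNumber q i ≠ 0 :=
  div_ne_zero (sub_ne_zero.2 (pow_ne_one_of_one_lt_norm hq hi))
    (sub_ne_zero.2 fun e => by simp [e] at hq)

theorem coverCount_eq (q : ℂ) (N M i : ℕ) :
    coverCount q (N + M) M i = q ^ M * (q ^ N - q ^ i) / (q ^ i * (q - 1)) := by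
  rw [coverCount]
  congr 1 <;> ring

theorem coverCount_self (q : ℂ) (N M : ℕ) : coverCount q (N + M) M N = 0 := by
  simp [coverCount]

theorem coverCount_sub_pow_ne_zero {q : ℂ} (hq : 1 < ‖q‖) {N M i : ℕ} (hi : i + 1 < N) :
    coverCount q (N + M) M i - q ^ M ≠ 0 := by
  have hq0 : q ≠ 0 := fun e => by simp [e] at hq; linarith
  have hq1 : q - 1 ≠ 0 := sub_ne_zero.2 fun e => by simp [e] at hq
  obtain ⟨k, rfl⟩ : ∃ k, N = i + 1 + (k + 1) := ⟨N - i - 2, by omega⟩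
  have hk : q ^ (k + 1) - 1 ≠ 0 := sub_ne_zero.2 (pow_ne_one_of_one_lt_norm hq (by omega))
  have : coverCount q (i + 1 + (k + 1) + M) M i - q ^ M =
      q ^ M * q * (q ^ (k + 1) - 1) / (q - 1) := by
    rw [coverCount_eq]
    field_simp
    ring
  rw [this]
  exact div_ne_zero (mul_ne_zero (mul_ne_zero (pow_ne_zero _ hq0) hq0) hk) hq1

theorem coverCount_ne_zero {q : ℂ} (hq : 1 < ‖q‖) {N M i : ℕ} (hi : i < N) :
    coverCount q (N + M) M i ≠ 0 := by
  have hq0 : q ≠ 0 := fun e => by simp [e] at hq; linarith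
  have hq1 : q - 1 ≠ 0 := sub_ne_zero.2 fun e => by simp [e] at hq
  obtain ⟨k, rfl⟩ : ∃ k, N = i + (k + 1) := ⟨N - i - 1, by omega⟩
  have hk : q ^ (k + 1) - 1 ≠ 0 := sub_ne_zero.2 (pow_ne_one_of_one_lt_norm hq (by omega))
  have : coverCount q (i + (k + 1) + M) M i = q ^ M * (q ^ (k + 1) - 1) / (q - 1) := by
    rw [coverCount_eq]
    field_simp
    ring
  rw [this]
  exact div_ne_zero (mul_ne_zero (pow_ne_zero _ hq0) hk) hq1

variable {F H : Type*} [Field F] [AddCommGroup H] [Module F H] {h : Submodule F H}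
variable [Fintype F] [FiniteDimensional F H]

/-- The component of degree `-1`: it is a symmetric quadratic relation between neighbours in `θ`, and
two consecutive ones differ by a multiple of `θ i - θ (i + 2)`. -/
theorem add_sub_mul_eq_of_tridiagonal {N M : ℕ} (hH : finrank F H = N + M) (hh : finrank F h = M)
    {α α' θ θ' : ℕ → ℂ} (hα' : ∀ i, 1 ≤ i → i ≤ N → α' i ≠ 0)
    (hθ : ∀ i ≤ N, ∀ j ≤ N, i ≠ j → θ i ≠ θ j) {β γ ϱ : ℂ}
    (hT : tridiagonalElement β γ ϱ (matA h N α θ) (matAStar h N α' θ') = 0)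
    {i : ℕ} (hi : i + 2 ≤ N) : θ i + θ (i + 2) - β * θ (i + 1) = γ := by
  have hq := one_lt_norm_card F
  have key : ∀ j, j + 1 ≤ N →
      θ j ^ 2 - β * θ j * θ (j + 1) + θ (j + 1) ^ 2 - γ * (θ j + θ (j + 1)) - ϱ = 0 := by
    intro j hj
    obtain ⟨y, hy⟩ := exists_finrank_eq hH hh hj
    have h1 := tridiagonalOp_eq_zero isLevelEigenvector_one (finrank_space_le hH hh) hT
      (y := y) one_ne_zero (Pi.single j 1)
    rw [hy, tridiagonalOp_single_pred, if_pos (by omega)] at h1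
    exact (mul_eq_zero.1 h1).resolve_left (mul_ne_zero
      (mul_ne_zero (hα' _ (by omega) hj) (qNumber_ne_zero hq (by omega)))
      (sub_ne_zero.2 (hθ j (by omega) (j + 1) hj (by omega))))
  have hne : θ i - θ (i + 2) ≠ 0 := sub_ne_zero.2 (hθ i (by omega) (i + 2) hi (by omega))
  refine mul_left_cancel₀ hne ?_
  linear_combination key i (by omega) - key (i + 1) hi

/-- The component of degree `3`. -/
theorem thirdDiff_eq_zero_of_tridiagonal {N M : ℕ} (hH : finrank F H = N + M)
    (hh : finrank F h = M) {α α' θ θ' : ℕ → ℂ} (hα : ∀ i < N, α i ≠ 0) {β γ ϱ : ℂ}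
    (hT : tridiagonalElement β γ ϱ (matA h N α θ) (matAStar h N α' θ') = 0)
    {i : ℕ} (hi : i + 3 ≤ N) : thirdDiff β θ' i = 0 := by
  have hq := one_lt_norm_card F
  obtain ⟨y, hy⟩ := exists_finrank_eq hH hh (i := i) (by omega)
  have h1 := tridiagonalOp_eq_zero isLevelEigenvector_one (finrank_space_le hH hh) hT
    (y := y) one_ne_zero (Pi.single (i + 3) 1)
  rw [hy, tridiagonalOp_single_add_three _ _ _ _ _ _ _ _ (if_neg (by omega)),
    if_pos (by omega), if_pos (by omega), if_pos (by omega), hH, hh] at h1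
  refine (mul_eq_zero.1 h1).resolve_left ?_
  exact mul_ne_zero (mul_ne_zero
    (mul_ne_zero (hα _ (by omega)) (coverCount_ne_zero hq (by omega)))
    (mul_ne_zero (hα _ (by omega)) (coverCount_ne_zero hq (by omega))))
    (mul_ne_zero (hα _ (by omega)) (coverCount_ne_zero hq (by omega)))

/-- What the component of degree `2` of the tridiagonal relation says about a level eigenvector. -/
theorem IsLevelEigenvector.thirdDiff_eq {f : AttenuatedSpace h → ℂ} {n m : ℕ → ℂ}
    (hf : IsLevelEigenvector f n m) {N M : ℕ} (hH : finrank F H = N + M) (hh : finrank F h = M)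
    {α α' θ θ' ξ : ℕ → ℂ} (hα : ∀ i < N, α i ≠ 0) (hξ : ∀ i < N, ξ i = α i * α' (i + 1))
    {β γ ϱ : ℂ} (hT : tridiagonalElement β γ ϱ (matA h N α θ) (matAStar h N α' θ') = 0)
    (hγ : ∀ i, i + 2 ≤ N → θ i + θ (i + 2) - β * θ (i + 1) = γ)
    {j : ℕ} (hj : j + 3 ≤ N) (hn1 : n (j + 1) ≠ 0) (hn2 : n (j + 2) ≠ 0)
    (hn3 : j + 3 = N → n (j + 3) = 0)
    (hy : ∃ y : AttenuatedSpace h, finrank F y.space = j + 1 ∧ f y ≠ 0) :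
    thirdDiff β (fun i => ξ i * (n i * m (i + 1))) j =
      (β + 1) * (diffMulDiff θ θ' (j + 1) - diffMulDiff θ θ' (j + 2)) := by
  obtain ⟨y, hy, hfy⟩ := hy
  have h1 := tridiagonalOp_eq_zero hf (finrank_space_le hH hh) hT hfy (Pi.single (j + 1 + 2) 1)
  rw [hy, tridiagonalOp_single_add_two _ _ _ _ _ _ _ _ (if_neg (by omega)) (hγ _ hj)] at h1
  have h2 := (mul_eq_zero.1 h1).resolve_left (by
    rw [if_pos (by omega), if_pos (by omega)]
    exact mul_ne_zero (mul_ne_zero (hα _ (by omega)) hn1) (mul_ne_zero (hα _ (by omega)) hn2))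
  have h3 : (if j + 3 < N then α (j + 3) * n (j + 3) else 0) * α' (j + 4) =
      ξ (j + 3) * n (j + 3) := by
    split_ifs with hlt
    · rw [hξ _ hlt]
      ring
    · rw [hn3 (by omega)]
      ring
  simp only [add_assoc, Nat.reduceAdd, add_tsub_cancel_right] at h2
  rw [if_pos (show j < N by omega), if_pos (show j + 1 < N by omega),
    if_pos (show j + 2 < N by omega), if_pos (show 1 ≤ j + 1 by omega),
    if_pos (show 1 ≤ j + 2 by omega), if_pos (show 1 ≤ j + 3 by omega),
    if_pos (show 1 ≤ j + 4 by omega)] at h2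
  simp only [thirdDiff, diffMulDiff, add_assoc, Nat.reduceAdd]
  rw [hξ j (by omega), hξ (j + 1) (by omega), hξ (j + 2) (by omega)]
  simp only [add_assoc, Nat.reduceAdd]
  linear_combination h2 + m (j + 4) * h3

end AttenuatedSpace

/-! ### Solving the recurrences -/

/-- The tridiagonal relation, read off from three level eigenvectors: the constant one, the one
attached to a coset of `h`, and the one attached to two cosets of `h`. The field `const` is the
degree-`2` equation of the first, with denominators cleared by `(q - 1) ^ 2`; `coset` and `cosets`
are, up to a nonzero factor, the differences of consecutive degree-`2` equations. -/
structure LevelRelations (q β : ℂ) (N M : ℕ) (ξ θ θ' : ℕ → ℂ) : Prop where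
  theta : ∀ j, j + 3 ≤ N → thirdDiff β θ j = 0
  theta' : ∀ j, j + 3 ≤ N → thirdDiff β θ' j = 0
  const : ∀ j, j + 3 ≤ N →
    thirdDiff β (fun i => ξ i * (q ^ M * (q ^ N - q ^ i) * (q * q ^ i - 1) * (q ^ i)⁻¹)) j =
      (β + 1) * (q - 1) ^ 2 * (diffMulDiff θ θ' (j + 1) - diffMulDiff θ θ' (j + 2))
  coset : ∀ j, j + 3 ≤ N → thirdDiff β (fun i => ξ i * (q ^ N - q ^ i)) j = 0
  cosets : ∀ j, j + 4 ≤ N → thirdDiff β (fun i => ξ i * (q ^ i - 1)) j = 0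

/-- The homogeneous relations are the differences of the degree-`2` equations of the three level
eigenvectors, which share their right-hand side. -/
theorem AttenuatedSpace.levelRelations {F H : Type*} [Field F] [Fintype F] [AddCommGroup H]
    [Module F H] [FiniteDimensional F H] {h : Submodule F H} {N M : ℕ} (hN : 2 ≤ N) (hM : 1 ≤ M)
    (hH : finrank F H = N + M) (hh : finrank F h = M)
    {α α' θ θ' ξ : ℕ → ℂ} (hα : ∀ i < N, α i ≠ 0) (hα' : ∀ i, 1 ≤ i → i ≤ N → α' i ≠ 0)
    (hθ : ∀ i ≤ N, ∀ j ≤ N, i ≠ j → θ i ≠ θ j) (hξ : ∀ i < N, ξ i = α i * α' (i + 1))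
    {β γ ϱ : ℂ} (hT : tridiagonalElement β γ ϱ (matA h N α θ) (matAStar h N α' θ') = 0) :
    LevelRelations (Fintype.card F) β N M ξ θ θ' := by
  have hq := one_lt_norm_card F
  obtain ⟨q, hqdef⟩ : ∃ q : ℂ, q = Fintype.card F := ⟨_, rfl⟩
  rw [← hqdef] at hq
  have hq0 : q ≠ 0 := fun e => by simp [e] at hq; linarith
  have hq1 : q - 1 ≠ 0 := sub_ne_zero.2 fun e => by simp [e] at hq
  have hγ : ∀ i, i + 2 ≤ N → θ i + θ (i + 2) - β * θ (i + 1) = γ := fun i hi =>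
    add_sub_mul_eq_of_tridiagonal hH hh hα' hθ hT hi
  obtain ⟨v, w, k, hv, hw, hk, hvk, hvw⟩ := exists_vectors hN hM hH hh
  have E0 : ∀ j, j + 3 ≤ N → thirdDiff β
      (fun i => ξ i * (coverCount q (N + M) M i * qNumber q (i + 1))) j =
      (β + 1) * (diffMulDiff θ θ' (j + 1) - diffMulDiff θ θ' (j + 2)) := by
    intro j hj
    have := (isLevelEigenvector_one (h := h)).thirdDiff_eq hH hh hα hξ hT hγ hj
    rw [hH, hh, ← hqdef] at this
    refine this (coverCount_ne_zero hq (by omega)) (coverCount_ne_zero hq (by omega))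
      (fun e => e ▸ coverCount_self _ _ _) ?_
    obtain ⟨y, hy⟩ := exists_finrank_eq hH hh (i := j + 1) (by omega)
    exact ⟨y, hy, one_ne_zero⟩
  have E1 : ∀ j, j + 3 ≤ N → thirdDiff β
      (fun i => ξ i * (coverCount q (N + M) M i * qNumber q i)) j =
      (β + 1) * (diffMulDiff θ θ' (j + 1) - diffMulDiff θ θ' (j + 2)) := by
    intro j hj
    have := (isLevelEigenvector_indicator_sub hv hk).thirdDiff_eq hH hh hα hξ hT hγ hj
    rw [hH, hh, ← hqdef] at this
    exact this (coverCount_ne_zero hq (by omega)) (coverCount_ne_zero hq (by omega))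
      (fun e => e ▸ coverCount_self _ _ _) (hvk _ (by omega) (by omega))
  have E2 : ∀ j, j + 4 ≤ N → thirdDiff β
      (fun i => ξ i * ((coverCount q (N + M) M i - q ^ M) * qNumber q i)) j =
      (β + 1) * (diffMulDiff θ θ' (j + 1) - diffMulDiff θ θ' (j + 2)) := by
    intro j hj
    have := (isLevelEigenvector_cosetIndicator_sub hv hw).thirdDiff_eq hH hh hα hξ hT hγ
      (show j + 3 ≤ N by omega)
    rw [hH, hh, ← hqdef] at this
    exact this (coverCount_sub_pow_ne_zero hq (by omega)) (coverCount_sub_pow_ne_zero hq (by omega))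
      (fun e => by omega) (hvw _ (by omega) (by omega))
  rw [← hqdef]
  refine ⟨fun j hj => ?_, fun j hj => thirdDiff_eq_zero_of_tridiagonal hH hh hα hT hj,
    fun j hj => ?_, fun j hj => ?_, fun j hj => ?_⟩
  · have e1 := hγ j (by omega)
    have e2 := hγ (j + 1) (by omega)
    simp only [thirdDiff, add_assoc, Nat.reduceAdd] at e2 ⊢
    linear_combination e1 - e2
  · have e0 := E0 j hj
    simp only [thirdDiff, coverCount_eq, qNumber] at e0 ⊢
    rw [mul_right_comm (β + 1), ← e0]
    simp only [pow_succ]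
    field_simp
  · have e0 := E0 j hj
    rw [← E1 j hj] at e0
    have hqM : q ^ M ≠ 0 := pow_ne_zero _ hq0
    refine (mul_eq_zero.1 ?_).resolve_left (div_ne_zero hqM hq1)
    simp only [thirdDiff, coverCount_eq, qNumber] at e0 ⊢
    rw [← sub_eq_zero] at e0
    rw [← e0]
    simp only [pow_succ]
    field_simp
    ring
  · have e1 := E1 j (by omega)
    rw [← E2 j hj] at e1
    have hqM : q ^ M ≠ 0 := pow_ne_zero _ hq0
    refine (mul_eq_zero.1 ?_).resolve_left (div_ne_zero hqM hq1)
    simp only [thirdDiff, qNumber] at e1 ⊢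
    rw [← sub_eq_zero] at e1
    rw [← e1]
    field_simp
    ring

theorem diffMulDiff_sub_of_eq_add_pow {t : ℂ} (ht0 : t ≠ 0) {N : ℕ} {u w : ℕ → ℂ}
    {a b c a' b' c' : ℂ} (hu : ∀ i ≤ N, u i = a + b * t ^ i + c * (t ^ i)⁻¹)
    (hw : ∀ i ≤ N, w i = a' + b' * t ^ i + c' * (t ^ i)⁻¹) {i : ℕ} (hi : i + 2 ≤ N) :
    diffMulDiff u w i - diffMulDiff u w (i + 1) =
      (t - 1) ^ 2 * (1 - t ^ 2) *
        (b * b' * (t ^ i) ^ 2 - c * c' * ((t ^ i) ^ 2 * t ^ 4)⁻¹) := by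
  have hti : t ^ i ≠ 0 := pow_ne_zero _ ht0
  simp only [diffMulDiff, add_assoc, Nat.reduceAdd]
  rw [hu i (by omega), hu (i + 1) (by omega), hu (i + 2) hi, hw i (by omega),
    hw (i + 1) (by omega), hw (i + 2) hi]
  simp only [pow_add, pow_one]
  field_simp
  ring

/-- The geometric alternative of `eq_add_inv_or_geometric` contradicts the relation of the constant
eigenvector. -/
theorem LevelRelations.add_inv {q β : ℂ} (hq : 1 < ‖q‖) {N M : ℕ} (hN : 6 ≤ N)
    {ξ θ θ' : ℕ → ℂ} (hξ : ∀ i < N, ξ i ≠ 0) (hR : LevelRelations q β N M ξ θ θ') :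
    β * q = q ^ 2 + 1 := by
  have hq0 : q ≠ 0 := fun e => by simp [e] at hq; linarith
  obtain ⟨h1, h2⟩ := thirdDiff_eq_zero_of_weighted hq (by omega) hR.coset hR.cosets
  rcases eq_add_inv_or_geometric hq hN hξ h1 h2 with hβ | ⟨t, hqt, hβt, ht⟩
  · exact hβ
  exfalso
  have ht0 : t ≠ 0 := fun e => by simp [e] at hqt
  have htn : ∀ n : ℕ, n ≠ 0 → t ^ n - 1 ≠ 0 := fun n hn e => by
    refine pow_ne_one_of_one_lt_norm hq hn ?_
    have : (q * t ^ 2) ^ n = 1 := by rw [hqt, one_pow]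
    rw [mul_pow, ← pow_mul, mul_comm 2, pow_mul, sub_eq_zero.1 e, one_pow, mul_one] at this
    exact this
  have ht1 : t - 1 ≠ 0 := by simpa using htn 1 one_ne_zero
  obtain ⟨a, b, c, hθ⟩ := exists_eq_add_pow_of_thirdDiff_eq_zero ht0
    (sub_ne_zero.1 (htn 2 two_ne_zero)) hβt hR.theta
  obtain ⟨a', b', c', hθ'⟩ := exists_eq_add_pow_of_thirdDiff_eq_zero ht0
    (sub_ne_zero.1 (htn 2 two_ne_zero)) hβt hR.theta'
  obtain rfl : q = (t ^ 2)⁻¹ := eq_inv_of_mul_eq_one_left hqt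
  obtain rfl : β = (t ^ 2 + 1) / t := by
    field_simp
    exact hβt
  -- in the relation for the constant eigenvector only the exponential `t ^ (3 * j)` survives on the
  -- left, and only `t ^ (2 * j)` and `t ^ (-2 * j)` on the right
  obtain ⟨U, hU⟩ : ∃ U, U = ((t ^ 2 + 1) / t + 1) * ((t ^ 2)⁻¹ - 1) ^ 2 *
    ((t - 1) ^ 2 * (1 - t ^ 2)) * (b * b' * t ^ 2) := ⟨_, rfl⟩
  obtain ⟨V, hV⟩ : ∃ V, V = ((t ^ 2 + 1) / t + 1) * ((t ^ 2)⁻¹ - 1) ^ 2 *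
    ((t - 1) ^ 2 * (1 - t ^ 2)) * (c * c' * (t ^ 6)⁻¹) := ⟨_, rfl⟩
  obtain ⟨X, hX⟩ : ∃ X, X = ξ 0 * ((t ^ 2)⁻¹) ^ M * ((t ^ 2)⁻¹) ^ N *
    ((t ^ 3 - 1) * (t ^ 3 - t) * (t ^ 3 - t⁻¹)) := ⟨_, rfl⟩
  have key : ∀ j, j + 3 ≤ 5 → X * (t ^ j) ^ 3 = U * (t ^ j) ^ 2 - V * ((t ^ j) ^ 2)⁻¹ := by
    intro j hj
    have hc := hR.const j (by omega)
    rw [diffMulDiff_sub_of_eq_add_pow ht0 hθ hθ' (by omega)] at hc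
    have hL : thirdDiff ((t ^ 2 + 1) / t) (fun i => ξ i * (((t ^ 2)⁻¹) ^ M *
        (((t ^ 2)⁻¹) ^ N - ((t ^ 2)⁻¹) ^ i) * ((t ^ 2)⁻¹ * ((t ^ 2)⁻¹) ^ i - 1) *
        (((t ^ 2)⁻¹) ^ i)⁻¹)) j = X * (t ^ j) ^ 3 := by
      have htj : t ^ j ≠ 0 := pow_ne_zero _ ht0
      have hsq : (t ^ 2) ^ j = (t ^ j) ^ 2 := by rw [← pow_mul, ← pow_mul, mul_comm]
      simp only [thirdDiff]
      rw [ht j (by omega), ht (j + 1) (by omega), ht (j + 2) (by omega), ht (j + 3) hj, hX]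
      generalize ((t ^ 2)⁻¹) ^ N = Z
      generalize ((t ^ 2)⁻¹) ^ M = W
      simp only [pow_add, pow_one, inv_pow, hsq]
      generalize t ^ j = s at *
      field_simp
      ring
    rw [← hL, hc, hU, hV]
    have htj : t ^ j ≠ 0 := pow_ne_zero _ ht0
    simp only [pow_add, pow_one]
    field_simp
  have k0 := key 0 (by omega)
  have k1 := key 1 (by omega)
  have k2 := key 2 (by omega)
  have hX0 : X * ((t - 1) * (t ^ 5 - 1)) = 0 := by
    field_simp at k0 k1 k2
    -- the three instances eliminate `U` and `V`
    refine (mul_eq_zero.1 ?_).resolve_right (pow_ne_zero 4 ht0)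
    linear_combination k2 - (t ^ 4 + 1) * k1 + t ^ 4 * k0
  have hX1 : X ≠ 0 := by
    rw [hX]
    have e1 : t ^ 3 - t = t * (t ^ 2 - 1) := by ring
    have e2 : t ^ 3 - t⁻¹ = t⁻¹ * (t ^ 4 - 1) := by field_simp
    rw [e1, e2]
    have := hξ 0 (by omega)
    have h3 := htn 3 (by omega)
    have h2 := htn 2 (by omega)
    have h4 := htn 4 (by omega)
    positivity
  exact mul_ne_zero hX1 (mul_ne_zero ht1 (htn 5 (by omega))) hX0

/-- The general solution: `θ` and `θ'` are combinations of `1`, `q ^ i` and `q ^ (-i)`, and `ξ` is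
a combination of `1` and `q ^ (-i)` whose second coefficient is fixed by those of `θ` and `θ'`. -/
theorem LevelRelations.exists_parameters {q β : ℂ} (hq : 1 < ‖q‖) {N M : ℕ} (hN : 6 ≤ N)
    {ξ θ θ' : ℕ → ℂ} (hξ : ∀ i < N, ξ i ≠ 0) (hR : LevelRelations q β N M ξ θ θ') :
    ∃ a b c a' b' c' x : ℂ, b * b' = 0 ∧
      (∀ i < N, ξ i = x - q⁻¹ * (q ^ N)⁻¹ * (q ^ M)⁻¹ * (q ^ i)⁻¹ * (q - 1) ^ 2 * c * c') ∧
      (∀ i ≤ N, θ i = a + b * q ^ i + c * (q ^ i)⁻¹) ∧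
      (∀ i ≤ N, θ' i = a' + b' * q ^ i + c' * (q ^ i)⁻¹) := by
  have hβ := hR.add_inv hq hN hξ
  have hq0 : q ≠ 0 := fun e => by simp [e] at hq; linarith
  have hqn : ∀ n : ℕ, n ≠ 0 → q ^ n - 1 ≠ 0 := fun n hn =>
    sub_ne_zero.2 (pow_ne_one_of_one_lt_norm hq hn)
  have hq1 : q - 1 ≠ 0 := by simpa using hqn 1 one_ne_zero
  obtain ⟨a, b, c, hθ⟩ := exists_eq_add_pow_of_thirdDiff_eq_zero hq0
    (sub_ne_zero.1 (hqn 2 two_ne_zero)) hβ hR.theta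
  obtain ⟨a', b', c', hθ'⟩ := exists_eq_add_pow_of_thirdDiff_eq_zero hq0
    (sub_ne_zero.1 (hqn 2 two_ne_zero)) hβ hR.theta'
  obtain ⟨-, h2⟩ := thirdDiff_eq_zero_of_weighted hq (by omega) hR.coset hR.cosets
  have hrec : ∀ j, j + 3 ≤ N → q * ξ (j + 2) = (q + 1) * ξ (j + 1) - ξ j := by
    intro j hj
    have hs : q ^ 2 + q + 1 ≠ 0 := fun e => hqn 3 (by omega) (by linear_combination (q - 1) * e)
    refine mul_left_cancel₀ hs ?_
    linear_combination h2 j hj + ((q + 1) * ξ (j + 1) - q * ξ (j + 2)) * hβ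
  obtain ⟨y, hy⟩ : ∃ y, y = (ξ 0 - ξ 1) * q / (q - 1) := ⟨_, rfl⟩
  have hξy : ∀ i < N, ξ i = (ξ 0 - y) + y * (q ^ i)⁻¹ := by
    intro i
    induction i using Nat.strong_induction_on with
    | _ i ih =>
      intro hi
      rcases i with _ | _ | j
      · simp
      · rw [hy]
        field_simp
        ring
      · have e0 := ih j (by omega) (by omega)
        have e1 := ih (j + 1) (by omega) (by omega)
        have e2 := hrec j (by omega)
        have hqj : q ^ j ≠ 0 := pow_ne_zero _ hq0
        refine mul_left_cancel₀ hq0 ?_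
        rw [show j + 1 + 1 = j + 2 from rfl, e2, e1, e0]
        simp only [pow_add, pow_one]
        field_simp
        ring
  have key : ∀ j, j + 4 ≤ N →
      y * q ^ M * q ^ N * q = (q - 1) ^ 2 * (b * b' * (q ^ j) ^ 4 * q ^ 8 - c * c') := by
    intro j hj
    have hc := hR.const j (by omega)
    rw [diffMulDiff_sub_of_eq_add_pow hq0 hθ hθ' (by omega)] at hc
    obtain rfl : β = (q ^ 2 + 1) / q := by
      field_simp
      exact hβ
    have hne : (q ^ 2 - 1) * (q ^ 3 - 1) * (q - 1) ≠ 0 :=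
      mul_ne_zero (mul_ne_zero (hqn 2 (by omega)) (hqn 3 (by omega))) hq1
    refine mul_left_cancel₀ hne ?_
    have hqj : q ^ j ≠ 0 := pow_ne_zero _ hq0
    have hL : thirdDiff ((q ^ 2 + 1) / q)
        (fun i => ξ i * (q ^ M * (q ^ N - q ^ i) * (q * q ^ i - 1) * (q ^ i)⁻¹)) j =
        -y * q ^ M * q ^ N * ((q ^ 2 - 1) * (q ^ 3 - 1) * (q - 1)) / ((q ^ j) ^ 2 * q ^ 6) := by
      simp only [thirdDiff]
      rw [hξy j (by omega), hξy (j + 1) (by omega), hξy (j + 2) (by omega),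
        hξy (j + 3) (by omega)]
      generalize q ^ N = Z
      generalize q ^ M = W
      simp only [pow_add, pow_one]
      generalize q ^ j = s at *
      field_simp
      ring
    rw [hL, div_eq_iff (mul_ne_zero (pow_ne_zero _ hqj) (pow_ne_zero _ hq0))] at hc
    refine Eq.trans (b := -q * (-y * q ^ M * q ^ N * ((q ^ 2 - 1) * (q ^ 3 - 1) * (q - 1)))) ?_ ?_
    · ring
    rw [hc]
    simp only [pow_add, pow_one]
    field_simp
    ring
  have hbb : b * b' = 0 := by
    have k0 := key 0 (by omega)
    have k1 := key 1 (by omega)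
    have hne : (q - 1) ^ 2 * q ^ 8 * (q ^ 4 - 1) ≠ 0 :=
      mul_ne_zero (mul_ne_zero (pow_ne_zero _ hq1) (pow_ne_zero _ hq0)) (hqn 4 (by omega))
    refine (mul_eq_zero.1 ?_).resolve_right hne
    linear_combination k0 - k1
  refine ⟨a, b, c, a', b', c', ξ 0 - y, hbb, fun i hi => ?_, hθ, hθ'⟩
  have k0 := key 0 (by omega)
  rw [hbb] at k0
  have hqN : q ^ N ≠ 0 := pow_ne_zero _ hq0
  have hqM : q ^ M ≠ 0 := pow_ne_zero _ hq0
  have hqi : q ^ i ≠ 0 := pow_ne_zero _ hq0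
  have hyy : y = -(q - 1) ^ 2 * (c * c') / (q ^ M * q ^ N * q) := by
    field_simp
    linear_combination k0
  rw [hξy i hi, hyy]
  field_simp
  ring

end

/-! ### The classification -/

theorem mainTheorem1 {F H : Type*} [Field F] [Fintype F] [AddCommGroup H] [Module F H]
    [FiniteDimensional F H] (N M : ℕ) (hN : 6 ≤ N) (hM : 1 ≤ M)
    (hH : Module.finrank F H = N + M)
    (h : Submodule F H) (hh : Module.finrank F h = M)
    (q : ℂ) (hq : q = (Fintype.card F : ℂ))
    (α α' θ θ' : ℕ → ℂ)
    (hα : ∀ i < N, α i ≠ 0)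
    (hα' : ∀ i, 1 ≤ i → i ≤ N → α' i ≠ 0)
    (hθ : ∀ i ≤ N, ∀ j ≤ N, i ≠ j → θ i ≠ θ j)
    (hθ' : ∀ i ≤ N, ∀ j ≤ N, i ≠ j → θ' i ≠ θ' j)
    (ξ : ℕ → ℂ) (hξ : ∀ i < N, ξ i = α i * α' (i + 1))
    (β γ γ' ϱ ϱ' : ℂ)
    (hB : tridiagonalElement β γ ϱ
      (AttenuatedSpace.matA h N α θ) (AttenuatedSpace.matAStar h N α' θ') = 0)
    (hB' : tridiagonalElement β γ' ϱ'
      (AttenuatedSpace.matAStar h N α' θ') (AttenuatedSpace.matA h N α θ) = 0) :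
    β = q + q⁻¹ ∧
    ∀ Q : ℂ, Q ≠ 0 → β = Q + Q⁻¹ →
      (Q = q ∨ Q = q⁻¹) ∧
      ∃ a b c a' b' c' x : ℂ,
        -- Case I
        (Q = q ∧ c ≠ 0 ∧ c' ≠ 0 ∧
          ( -- Case I⁺
            (b ≠ 0 ∧ b' = 0 ∧ FitsRow N ξ θ θ'
              (fun i => x - q ^ (-1 - N - M - i : ℤ) * (q - 1) ^ 2 * c * c')
              (fun i => a + b * q ^ i + c * q ^ (-i : ℤ))
              (fun i => a' + c' * q ^ (-i : ℤ))) ∨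
            -- Case I⁻
            (b = 0 ∧ b' ≠ 0 ∧ FitsRow N ξ θ θ'
              (fun i => x - q ^ (-1 - N - M - i : ℤ) * (q - 1) ^ 2 * c * c')
              (fun i => a + c * q ^ (-i : ℤ))
              (fun i => a' + b' * q ^ i + c' * q ^ (-i : ℤ))) ∨
            -- Case I⁰
            (b = 0 ∧ b' = 0 ∧ FitsRow N ξ θ θ'
              (fun i => x - q ^ (-1 - N - M - i : ℤ) * (q - 1) ^ 2 * c * c')
              (fun i => a + c * q ^ (-i : ℤ))
              (fun i => a' + c' * q ^ (-i : ℤ))))) ∨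
        -- Case II
        (Q = q⁻¹ ∧ b ≠ 0 ∧ b' ≠ 0 ∧
          ( -- Case II⁺
            (c ≠ 0 ∧ c' = 0 ∧ FitsRow N ξ θ θ'
              (fun i => x - q ^ (-1 - N - M - i : ℤ) * (q - 1) ^ 2 * b * b')
              (fun i => a + b * q ^ (-i : ℤ) + c * q ^ i)
              (fun i => a' + b' * q ^ (-i : ℤ))) ∨
            -- Case II⁻
            (c = 0 ∧ c' ≠ 0 ∧ FitsRow N ξ θ θ'
              (fun i => x - q ^ (-1 - N - M - i : ℤ) * (q - 1) ^ 2 * b * b')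
              (fun i => a + b * q ^ (-i : ℤ))
              (fun i => a' + b' * q ^ (-i : ℤ) + c' * q ^ i)) ∨
            -- Case II⁰
            (c = 0 ∧ c' = 0 ∧ FitsRow N ξ θ θ'
              (fun i => x - q ^ (-1 - N - M - i : ℤ) * (q - 1) ^ 2 * b * b')
              (fun i => a + b * q ^ (-i : ℤ))
              (fun i => a' + b' * q ^ (-i : ℤ))))) ∨
        -- Case III
        (x ≠ 0 ∧
          ( -- Case III⁺
            (b ≠ 0 ∧ b' = 0 ∧ c = 0 ∧ c' ≠ 0 ∧ FitsRow N ξ θ θ'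
              (fun _ => x)
              (fun i => a + b * q ^ i)
              (fun i => a' + c' * q ^ (-i : ℤ))) ∨
            -- Case III⁻
            (b = 0 ∧ b' ≠ 0 ∧ c ≠ 0 ∧ c' = 0 ∧ FitsRow N ξ θ θ'
              (fun _ => x)
              (fun i => a + c * q ^ (-i : ℤ))
              (fun i => a' + b' * q ^ i)))) := by
  have hq1 : 1 < ‖q‖ := hq ▸ AttenuatedSpace.one_lt_norm_card F
  have hq0 : q ≠ 0 := fun e => by simp [e] at hq1; linarith
  have hR : LevelRelations q β N M ξ θ θ' :=
    hq ▸ AttenuatedSpace.levelRelations (by omega) hM hH hh hα hα' hθ hξ hB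
  have hξ0 : ∀ i < N, ξ i ≠ 0 := fun i hi => by
    rw [hξ i hi]
    exact mul_ne_zero (hα i hi) (hα' _ (by omega) hi)
  have hβ : β = q + q⁻¹ := by
    have := hR.add_inv hq1 hN hξ0
    field_simp
    linear_combination this
  refine ⟨hβ, fun Q hQ0 hQ => ?_⟩
  have hQq : Q = q ∨ Q = q⁻¹ := by
    have h1 : (Q - q) * (Q - q⁻¹) = 0 := by
      rw [hβ] at hQ
      field_simp at hQ ⊢
      linear_combination -hQ
    exact (mul_eq_zero.1 h1).imp sub_eq_zero.1 sub_eq_zero.1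
  refine ⟨hQq, ?_⟩
  obtain ⟨a, b, c, a', b', c', x, hbb, hfξ, hfθ, hfθ'⟩ := hR.exists_parameters hq1 hN hξ0
  have hz : ∀ i : ℕ, q ^ (-1 - N - M - i : ℤ) = q⁻¹ * (q ^ N)⁻¹ * (q ^ M)⁻¹ * (q ^ i)⁻¹ := by
    intro i
    simp only [zpow_sub₀ hq0, zpow_neg, zpow_one, zpow_natCast, div_eq_mul_inv]
  simp only [FitsRow, hz, zpow_neg, zpow_natCast]
  -- the parameters that vanish in a row of the table are absent from its formulas
  have hb0 : b = 0 → ∀ i ≤ N, θ i = a + c * (q ^ i)⁻¹ := fun e i hi => by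
    rw [hfθ i hi, e]; ring
  have hc0 : c = 0 → ∀ i ≤ N, θ i = a + b * q ^ i := fun e i hi => by
    rw [hfθ i hi, e]; ring
  have hb0' : b' = 0 → ∀ i ≤ N, θ' i = a' + c' * (q ^ i)⁻¹ := fun e i hi => by
    rw [hfθ' i hi, e]; ring
  have hc0' : c' = 0 → ∀ i ≤ N, θ' i = a' + b' * q ^ i := fun e i hi => by
    rw [hfθ' i hi, e]; ring
  have swap : ∀ i ≤ N, θ i = a + c * (q ^ i)⁻¹ + b * q ^ i := fun i hi => by
    rw [hfθ i hi]; ring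
  have swap' : ∀ i ≤ N, θ' i = a' + c' * (q ^ i)⁻¹ + b' * q ^ i := fun i hi => by
    rw [hfθ' i hi]; ring
  have hrow : (b ≠ 0 ∧ b' = 0) ∨ (b = 0 ∧ b' ≠ 0) ∨ (b = 0 ∧ b' = 0) := by
    rcases mul_eq_zero.1 hbb with e | e
    · exact Or.inr ((em (b' = 0)).symm.imp (⟨e, ·⟩) (⟨e, ·⟩))
    · exact (em (b = 0)).symm.imp (⟨·, e⟩) fun e' => Or.inr ⟨e', e⟩
  by_cases hcc : c * c' = 0
  · -- `ξ` is constant, so it cannot vanish; the sequences `θ` and `θ'` are not constant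
    have hx : ∀ i < N, ξ i = x := fun i hi => by
      rw [hfξ i hi, mul_assoc _ c, hcc, mul_zero, sub_zero]
    have hx0 : x ≠ 0 := hx 0 (by omega) ▸ hξ0 0 (by omega)
    have hbc : ¬(b = 0 ∧ c = 0) := fun ⟨e, e'⟩ => hθ 0 (by omega) 1 (by omega) (by omega) (by
      rw [hb0 e 0 (by omega), hb0 e 1 (by omega), e', zero_mul, zero_mul])
    have hbc' : ¬(b' = 0 ∧ c' = 0) := fun ⟨e, e'⟩ => hθ' 0 (by omega) 1 (by omega) (by omega) (by
      rw [hb0' e 0 (by omega), hb0' e 1 (by omega), e', zero_mul, zero_mul])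
    refine ⟨a, b, c, a', b', c', x, Or.inr (Or.inr ⟨hx0, ?_⟩)⟩
    rcases mul_eq_zero.1 hcc with e | e
    · have hb : b ≠ 0 := fun e' => hbc ⟨e', e⟩
      have hb' : b' = 0 := (mul_eq_zero.1 hbb).resolve_left hb
      exact Or.inl ⟨hb, hb', e, fun e' => hbc' ⟨hb', e'⟩, hx, hc0 e, hb0' hb'⟩
    · have hb' : b' ≠ 0 := fun e' => hbc' ⟨e', e⟩
      have hb : b = 0 := (mul_eq_zero.1 hbb).resolve_right hb'
      exact Or.inr ⟨hb, hb', fun e' => hbc ⟨hb, e'⟩, e, hx, hb0 hb, hc0' e⟩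
  · have hc : c ≠ 0 := left_ne_zero_of_mul hcc
    have hc' : c' ≠ 0 := right_ne_zero_of_mul hcc
    rcases hQq with hQ | hQ
    · refine ⟨a, b, c, a', b', c', x, Or.inl ⟨hQ, hc, hc', ?_⟩⟩
      rcases hrow with ⟨h1, h2⟩ | ⟨h1, h2⟩ | ⟨h1, h2⟩
      · exact Or.inl ⟨h1, h2, hfξ, hfθ, hb0' h2⟩
      · exact Or.inr (Or.inl ⟨h1, h2, hfξ, hb0 h1, hfθ'⟩)
      · exact Or.inr (Or.inr ⟨h1, h2, hfξ, hb0 h1, hb0' h2⟩)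
    · -- for `Q = q⁻¹` the coefficients of `q ^ i` and `q ^ (-i)` exchange their names
      refine ⟨a, c, b, a', c', b', x, Or.inr (Or.inl ⟨hQ, hc, hc', ?_⟩)⟩
      rcases hrow with ⟨h1, h2⟩ | ⟨h1, h2⟩ | ⟨h1, h2⟩
      · exact Or.inl ⟨h1, h2, hfξ, swap, hb0' h2⟩
      · exact Or.inr (Or.inl ⟨h1, h2, hfξ, hb0 h1, swap'⟩)
      · exact Or.inr (Or.inr ⟨h1, h2, hfξ, hb0 h1, hb0' h2⟩)
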